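/- **Setting.** Let $X$ be a unimodular triangulation of a rationally triangulable compact smooth tropical variety (more generally, $X$ may be any finite complex of unimodular polyhedra $\mathrm{conv}(A)+\mathrm{cone}(B)$ with integral affine charts around its vertices, such that around each vertex the polyhedra span a fan). Let $X_{\mathrm f}$ be the set of bounded faces of $X$, i.e. those not meeting the boundary at infinity; $|\delta|$ denotes dimension. For $\delta\in X_{\mathrm f}$ let $\Sigma^\delta$ be the star fan, in the quotient of the lattice by the directions of $\delta$, and put $$H^{k}(\delta)=A^{k/2}(\Sigma^\delta)_{\mathbb Q}\ \text{ for } k \text{ even},\qquad H^k(\delta)=0\ \text{ for } k\text{ odd},$$ where $A^\bullet(\Sigma^\delta)_{\mathbb Q}=\mathbb Q[x_\rho : \rho \text{ a ray}]/(I+J)$ is the Chow ring, $I$ being generated by the products of variables whose rays do not span a cone and $J$ by the forms $\sum_\rho m(e_\rho)x_\rho$ with $m$ an integral linear form, $e_\rho$ being the primitive vector of $\rho$. (In the smooth case $A^{k/2}(\Sigma^\delta)_{\mathbb Q}\simeq H^{k/2,k/2}_{\mathrm{trop}}(\overline\Sigma^\delta)$, which is the whole degree $k$ cohomology.) For $\gamma$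 a facet of $\delta$, with corresponding ray $\rho_{\delta/\gamma}$ of $\Sigma^\gamma$, let $i^*:H^k(\gamma)\to H^k(\delta)$ be the restriction ring homomorphism and $\mathrm{gys}: H^k(\delta)\to H^{k+2}(\gamma)$ the Gysin map; they satisfy $\mathrm{gys}(i^*x)=x\cdot x_{\rho_{\delta/\gamma}}$. Fix orientations of the faces, and let $$\mathrm{ST}_1^{a,b}=\bigoplus_{s\ge |a|,\ s\equiv a\,(2)}\mathrm{ST}_1^{a,b,s},\qquad \mathrm{ST}_1^{a,b,s}=\bigoplus_{\delta\in X_{\mathrm f},\,|\delta|=s}H^{a+b-s}(\delta),$$ with the differential $d=i^*+\mathrm{gys}$ of bidegree $(1,0)$, the components of $i^*$ and $\mathrm{gys}$ being taken with the usual incidence signs. Let $N:\mathrm{ST}_1^{a,b}\to\mathrm{ST}_1^{a+2,b-2}$ be the identity on $\mathrm{ST}_1^{a,b,s}$ if $s\ge|a+2|$, and $0$ otherwise. It commutes with $d$. Let $K^{\bullet,b}=\ker(N:\mathrm{ST}_1^{\bullet,b}\to\mathrm{ST}_1^{\bullet,b-2}[2])$ and $R^{\bullet,b}=\mathrm{coker}(N:\mathrm{ST}_1^{\bullet,b+2}[-2]\to\mathrm{ST}_1^{\bullet,b})$.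 **Proposition.** Let $p$ be an even integer, let $N$ denote $N:\mathrm{ST}_1^{\bullet,p+2}\to\mathrm{ST}_1^{\bullet,p}[2]$, and let $C=\mathrm{Cone}^\bullet(N)[-1]$ be its shifted mapping cone, so that $C^a=\mathrm{ST}_1^{a,p+2}\oplus\mathrm{ST}_1^{a+1,p}$. 1. The triangle $$ C\longrightarrow \mathrm{ST}_1^{\bullet,p+2}\xrightarrow{\ N\ }\mathrm{ST}_1^{\bullet,p}[2]\xrightarrow{\,+1\,} C[1]$$ with the canonical morphisms is distinguished in the bounded derived category of cochain complexes of $\mathbb Q$-vector spaces. 2. Let $g:K^{\bullet,p+2}\to C$ be induced by the inclusion $K^{\bullet,p+2}\subset\mathrm{ST}_1^{\bullet,p+2}$, let $h:C\to R^{\bullet,p}[1]$ be induced by the projection $\mathrm{ST}_1^{\bullet,p}\to R^{\bullet,p}$, and let $T=\mathrm{Cone}^\bullet(g)[-1]$, so that $T^a=K^{a,p+2}\oplus\mathrm{ST}_1^{a-1,p+2}\oplus\mathrm{ST}_1^{a,p}$. Then the projection $\pi:T\to R^{\bullet,p}$ of the last summand onto $R^{\bullet,p}$ is a quasi-isomorphism.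 There is a morphism $f:R^{\bullet,p}\to K^{\bullet,p+2}$ (of degree $0$) in the bounded derived category such that $f\circ\pi$ is the canonical projection $T\to K^{\bullet,p+2}$, and the triangle $$ R^{\bullet,p}\xrightarrow{\ f\ }K^{\bullet,p+2}\xrightarrow{\ g\ }C\xrightarrow{\ h\ }R^{\bullet,p}[1]$$ is distinguished in the bounded derived category. -/

import Mathlib

set_option linter.unusedSectionVars false

universe u v w

namespace TropicalSteenbrink

open Finset MvPolynomial CategoryTheory CategoryTheory.Limits CochainComplex
  CochainComplex.HomComplex

/-- The combinatorial data of a unimodular polyhedral complex (for instance of a unimodular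
triangulation of a compact smooth tropical variety), restricted to the polyhedra which are not
contained in the boundary at infinity.

* `V` is the (finite) set of vertices lying in the finite part.  It carries a linear order, which is
  only used to write down reference orientations of the simplices.
* `D` is the (finite) set of unbounded directions.
* `IsFace A B` says that the polyhedron `conv A + cone B`, with vertices `A` and with recession cone
  generated by the directions `B`, belongs to the complex.  The faces which do not meet the boundary
  at infinity are those with `B = ∅`; such a face is identified with its set `δ` of vertices and its
  dimension is `#δ - 1`.
* `N v` is the lattice of an integral affine chart at the vertex `v`, with `v` at the origin.  In this
  chart `vec v (Sum.inl w)` is the position of the vertex `w` (the vector from `v` to `w`), and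
  `vec v (Sum.inr y)` is the primitive generator of the direction `y`.  These vectors only matter when
  `w`, respectively `y`, occurs in a face together with `v`.

If the complex is a polyhedral complex in `N₀ ⊗ ℝ` with vertices in the lattice `N₀`, one takes
`N v = N₀` for all `v` and the transition maps below are the identity. -/
structure UnimodularComplex (V D : Type u) [LinearOrder V] [Fintype V] [DecidableEq D] [Fintype D]
    (N : V → Type v) [∀ v, AddCommGroup (N v)] [∀ v, Module.Free ℤ (N v)]
    [∀ v, Module.Finite ℤ (N v)] where
  /-- `conv A + cone B` is a polyhedron of the complex -/
  IsFace : Finset V → Finset D → Prop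
  nonempty_of_isFace : ∀ {A B}, IsFace A B → A.Nonempty
  /-- the complex contains all the faces of its polyhedra -/
  isFace_mono : ∀ {A A' B B'}, IsFace A B → A' ⊆ A → B' ⊆ B → A'.Nonempty → IsFace A' B'
  isFace_vertex : ∀ v, IsFace {v} ∅
  /-- position of a vertex, respectively primitive vector of a direction, in the chart at `v` -/
  vec : ∀ v : V, V ⊕ D → N v
  vec_self : ∀ v, vec v (Sum.inl v) = 0
  /-- unimodularity: the edge vectors at `v` of a polyhedron containing `v` and its unbounded
  directions are linearly independent, -/
  linearIndepOn : ∀ {v A B}, IsFace A B → v ∈ A →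
    LinearIndepOn ℤ (vec v) ((A.erase v).disjSum B : Finset (V ⊕ D))
  /-- and they span a saturated sublattice, that is, they form part of a basis of `N v`. -/
  saturated : ∀ {v A B}, IsFace A B → v ∈ A → ∀ (n : ℤ) (y : N v), n ≠ 0 →
    n • y ∈ Submodule.span ℤ (vec v '' ((A.erase v).disjSum B : Finset (V ⊕ D))) →
    y ∈ Submodule.span ℤ (vec v '' ((A.erase v).disjSum B : Finset (V ⊕ D)))
  /-- the cones spanned at `v` by the polyhedra containing `v` form a fan: a vector has at most one
  expression as a non-negative combination of the generators of one of these cones (it is enough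
  to test lattice vectors, the cones being unimodular). -/
  cone_inter : ∀ {v A B A' B'}, IsFace A B → v ∈ A → IsFace A' B' → v ∈ A' →
    ∀ c c' : V ⊕ D → ℕ, (∀ z ∉ (A.erase v).disjSum B, c z = 0) →
      (∀ z ∉ (A'.erase v).disjSum B', c' z = 0) →
      ∑ z, c z • vec v z = ∑ z, c' z • vec v z → c = c'
  /-- along an edge `{v, w}` the charts at `v` and at `w` differ by an integral affine map on the
  polyhedra containing this edge; `φ` is its linear part. -/
  exists_transition : ∀ {v w}, IsFace {v, w} ∅ → ∃ φ : N v →ₗ[ℤ] N w,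
    (∀ x, IsFace {v, w, x} ∅ → vec w (Sum.inl x) = φ (vec v (Sum.inl x)) + vec w (Sum.inl v)) ∧
    ∀ y, IsFace {v, w} {y} → vec w (Sum.inr y) = φ (vec v (Sum.inr y))

namespace UnimodularComplex

noncomputable section

variable {V D : Type u} [LinearOrder V] [Fintype V] [DecidableEq D] [Fintype D]
  {N : V → Type v} [∀ v, AddCommGroup (N v)] [∀ v, Module.Free ℤ (N v)]
  [∀ v, Module.Finite ℤ (N v)] (X : UnimodularComplex V D N)

/-- The rays of the star fan `Σ^δ` of a face `δ` in `N v / span δ` correspond to the faces of the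
complex which contain `δ` as a facet: the ray `Sum.inl w` is the one of the face with one more vertex
`w`, and the ray `Sum.inr y` is the one of the face with one more direction `y`.  Its primitive
generator is the class of `vec v z`, for `v ∈ δ`. -/
def IsRay (δ : Finset V) : V ⊕ D → Prop
  | Sum.inl w => w ∉ δ ∧ X.IsFace (insert w δ) ∅
  | Sum.inr y => X.IsFace δ {y}

/-- The rays in `S` generate a cone of the star fan `Σ^δ`. -/
def SpansCone (δ : Finset V) (S : Finset (V ⊕ D)) : Prop :=
  Disjoint δ S.toLeft ∧ X.IsFace (δ ∪ S.toLeft) S.toRight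

/-- The monomial relations of the Chow ring: `∏_{z ∈ S} x_z` for each set `S` which does not generate
a cone.  There is one variable for each `z : V ⊕ D`; the variables which do not correspond to rays
of `Σ^δ` are killed by these relations (take `S = {z}`). -/
def nonconeRelations (δ : Finset V) : Set (MvPolynomial (V ⊕ D) ℚ) :=
  {p | ∃ S : Finset (V ⊕ D), ¬ X.SpansCone δ S ∧ p = ∏ z ∈ S, MvPolynomial.X z}

open Classical in
/-- The linear form `∑_ρ m(e_ρ) x_ρ`, sum over the rays of `Σ^δ`. -/
def linearForm {v : V} (δ : Finset V) (m : N v →ₗ[ℤ] ℤ) :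
    MvPolynomial (V ⊕ D) ℚ :=
  ∑ z with X.IsRay δ z, (m (X.vec v z) : ℚ) • MvPolynomial.X z

/-- The linear relations of the Chow ring: `∑_ρ m(e_ρ) x_ρ` for each integral linear form `m`
vanishing on the linear span of `δ`. -/
def linearRelations (δ : Finset V) : Set (MvPolynomial (V ⊕ D) ℚ) :=
  {p | ∃ v ∈ δ, ∃ m : N v →ₗ[ℤ] ℤ,
    (∀ w ∈ δ, m (X.vec v (Sum.inl w)) = 0) ∧ p = X.linearForm δ m}

/-- The ideal of relations of the Chow ring of `Σ^δ`. -/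
def chowIdeal (δ : Finset V) : Ideal (MvPolynomial (V ⊕ D) ℚ) :=
  Ideal.span (X.nonconeRelations δ ∪ X.linearRelations δ)

/-- The Chow ring `A^•(Σ^δ)` of the star fan of `δ`, with rational coefficients. -/
abbrev Chow (δ : Finset V) : Type u := MvPolynomial (V ⊕ D) ℚ ⧸ X.chowIdeal δ

/-- The element `x_ρ` of the Chow ring. -/
def rayClass (δ : Finset V) (z : V ⊕ D) : X.Chow δ :=
  Ideal.Quotient.mkₐ ℚ (X.chowIdeal δ) (MvPolynomial.X z)

/-- The homogeneous part `A^j(Σ^δ)`. -/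
def chowDegree (δ : Finset V) (j : ℕ) : Submodule ℚ (X.Chow δ) :=
  (MvPolynomial.homogeneousSubmodule (V ⊕ D) ℚ j).map
    (Ideal.Quotient.mkₐ ℚ (X.chowIdeal δ)).toLinearMap

/-- `H^k(δ) = A^{k/2}(Σ^δ)` if `k` is even and non-negative, and `H^k(δ) = 0` otherwise. -/
def cohomology (δ : Finset V) (k : ℤ) : Submodule ℚ (X.Chow δ) :=
  ⨆ (j : ℕ) (_ : k = 2 * j), X.chowDegree δ j

/-- `γ` is a facet (a face of codimension one) of the bounded face `δ` of the complex. -/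
def Facet (γ δ : Finset V) : Prop := γ.Nonempty ∧ γ ⋖ δ ∧ X.IsFace δ ∅

variable {X}

theorem Facet.exists_eq {γ δ : Finset V} (h : X.Facet γ δ) : ∃ v ∉ γ, δ = insert v γ := by
  obtain ⟨v, hv, e⟩ := (Finset.covBy_iff_exists_insert).1 h.2.1
  exact ⟨v, hv, e.symm⟩

theorem Facet.isFace {γ δ : Finset V} (h : X.Facet γ δ) : X.IsFace γ ∅ :=
  X.isFace_mono h.2.2 h.2.1.1.le subset_rfl h.1

variable (X) in
theorem exists_functional {v : V} {A : Finset V} (hA : X.IsFace A ∅) (hv : v ∈ A)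
    (c : V → ℤ) : ∃ m : N v →ₗ[ℤ] ℤ, ∀ w ∈ A, w ≠ v → m (X.vec v (Sum.inl w)) = c w := by
  have li := X.linearIndepOn hA hv
  set s : Finset (V ⊕ D) := (A.erase v).disjSum ∅ with hs
  let P := Submodule.span ℤ (X.vec v '' s)
  have htf : Module.IsTorsionFree ℤ (N v ⧸ P) := by
    refine Module.IsTorsionFree.of_smul_eq_zero fun n y hy => ?_
    by_contra! hne
    obtain ⟨y, rfl⟩ := P.mkQ_surjective y
    rw [← map_smul, Submodule.mkQ_apply, Submodule.Quotient.mk_eq_zero] at hy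
    exact hne.2 ((Submodule.Quotient.mk_eq_zero P).2 (X.saturated hA hv n y hne.1 hy))
  obtain ⟨t, ht⟩ := Module.projective_lifting_property P.mkQ LinearMap.id P.mkQ_surjective
  have hmem : ∀ y, ((LinearMap.id : N v →ₗ[ℤ] N v) - t ∘ₗ P.mkQ) y ∈ P := by
    intro y
    rw [← Submodule.Quotient.mk_eq_zero, ← Submodule.mkQ_apply, LinearMap.sub_apply, map_sub]
    have := LinearMap.congr_fun ht (P.mkQ y)
    simp only [LinearMap.comp_apply, LinearMap.id_apply] at this ⊢
    rw [this, sub_self]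
  let q : N v →ₗ[ℤ] P := ((LinearMap.id : N v →ₗ[ℤ] N v) - t ∘ₗ P.mkQ).codRestrict P hmem
  have hq : ∀ y (hy : y ∈ P), q y = ⟨y, hy⟩ := by
    intro y hy
    apply Subtype.ext
    have : P.mkQ y = 0 := by rw [Submodule.mkQ_apply, Submodule.Quotient.mk_eq_zero]; exact hy
    simp [q, -Submodule.mkQ_apply, this]
  have li' : LinearIndependent ℤ (fun z : (s : Set (V ⊕ D)) => X.vec v z) := li
  have hr : Set.range (fun z : (s : Set (V ⊕ D)) => X.vec v z) = X.vec v '' s := by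
    ext; simp
  let b := Module.Basis.span li'
  let e : Submodule.span ℤ (Set.range (fun z : (s : Set (V ⊕ D)) => X.vec v z)) ≃ₗ[ℤ] P :=
    LinearEquiv.ofEq _ _ (by rw [hr])
  let m₀ := b.constr ℤ (fun z => Sum.elim c (fun _ => (0 : ℤ)) z.1)
  refine ⟨m₀ ∘ₗ e.symm.toLinearMap ∘ₗ q, fun w hw hwv => ?_⟩
  have hs' : (Sum.inl w : V ⊕ D) ∈ (s : Set (V ⊕ D)) := by simp [hs, hw, hwv]
  have hP : X.vec v (Sum.inl w) ∈ P := Submodule.subset_span ⟨_, hs', rfl⟩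
  simp only [LinearMap.comp_apply, hq _ hP]
  have : e.symm ⟨_, hP⟩ = b ⟨_, hs'⟩ := by
    apply Subtype.ext
    simp [e, b, Module.Basis.span_apply]
  simp only [LinearEquiv.coe_coe, this, m₀, Module.Basis.constr_basis]
  rfl

theorem Facet.exists_functional {γ δ : Finset V} (h : X.Facet γ δ) :
    ∃ v ∈ γ, ∃ m : N v →ₗ[ℤ] ℤ, (∀ w ∈ γ, m (X.vec v (Sum.inl w)) = 0) ∧
      ∀ w ∈ δ \ γ, m (X.vec v (Sum.inl w)) = 1 := by
  obtain ⟨v, hv⟩ := h.1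
  obtain ⟨m, hm⟩ := X.exists_functional h.2.2 (h.2.1.1.le hv) fun w => if w ∈ γ then 0 else 1
  refine ⟨v, hv, m, fun w hw => ?_, fun w hw => ?_⟩
  · by_cases hwv : w = v
    · rw [hwv, X.vec_self, map_zero]
    · rw [hm w (h.2.1.1.le hw) hwv, if_pos hw]
  · rw [mem_sdiff] at hw
    rw [hm w hw.1 (fun e => hw.2 (e ▸ hv)), if_neg hw.2]

/-! affine functions -/

variable (X) in
/-- The vertices and directions `z` which occur in a face of the complex containing `δ`. -/
def Star (δ : Finset V) : V ⊕ D → Prop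
  | Sum.inl w => X.IsFace (insert w δ) ∅
  | Sum.inr y => X.IsFace δ {y}

/-- The constant function `1`, as a function on vertices and directions (value, respectively slope). -/
def ones : V ⊕ D → ℤ := Sum.elim (fun _ => 1) fun _ => 0

variable (X) in
/-- `f` is the restriction of an integral affine function in the chart at `v`
(value on vertices, slope along directions). -/
def Aff (δ : Finset V) (v : V) (f : V ⊕ D → ℤ) : Prop :=
  ∃ (m : N v →ₗ[ℤ] ℤ) (c : ℤ), ∀ z, X.Star δ z → f z = m (X.vec v z) + c * ones z

theorem IsRay.star {δ : Finset V} {z : V ⊕ D} (h : X.IsRay δ z) : X.Star δ z := by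
  rcases z with w | y
  · exact h.2
  · exact h

theorem Star.mono {γ δ : Finset V} (hγ : γ.Nonempty) (h : γ ⊆ δ) {z : V ⊕ D}
    (hz : X.Star δ z) : X.Star γ z := by
  rcases z with w | y
  · exact X.isFace_mono hz (insert_subset_insert _ h) subset_rfl (insert_nonempty _ _)
  · exact X.isFace_mono hz h subset_rfl hγ

theorem Aff.mono {γ δ : Finset V} (hγ : γ.Nonempty) (h : γ ⊆ δ) {v : V} {f : V ⊕ D → ℤ}
    (hf : X.Aff γ v f) : X.Aff δ v f := by
  obtain ⟨m, c, hm⟩ := hf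
  exact ⟨m, c, fun z hz => hm z (hz.mono hγ h)⟩

theorem Aff.sub {δ : Finset V} {v : V} {f g : V ⊕ D → ℤ}
    (hf : X.Aff δ v f) (hg : X.Aff δ v g) : X.Aff δ v (f - g) := by
  obtain ⟨m, c, hm⟩ := hf
  obtain ⟨m', c', hm'⟩ := hg
  refine ⟨m - m', c - c', fun z hz => ?_⟩
  simp only [Pi.sub_apply, hm z hz, hm' z hz, LinearMap.sub_apply]
  ring

theorem Aff.smul {δ : Finset V} {v : V} {f : V ⊕ D → ℤ}
    (hf : X.Aff δ v f) (a : ℤ) : X.Aff δ v (a • f) := by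
  obtain ⟨m, c, hm⟩ := hf
  refine ⟨a • m, a * c, fun z hz => ?_⟩
  simp only [Pi.smul_apply, hm z hz, LinearMap.smul_apply, smul_eq_mul]
  ring

theorem Aff.sum {δ : Finset V} {v : V} {ι : Type*} (s : Finset ι) {f : ι → V ⊕ D → ℤ}
    (hf : ∀ i ∈ s, X.Aff δ v (f i)) : X.Aff δ v (∑ i ∈ s, f i) := by
  classical
  induction s using Finset.induction_on with
  | empty => exact ⟨0, 0, by simp⟩
  | insert i s hi ih =>
    rw [Finset.sum_insert hi]
    have h1 := hf i (mem_insert_self _ _)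
    have h2 := (ih fun j hj => hf j (mem_insert_of_mem hj)).smul (-1)
    have := h1.sub h2
    convert this using 1
    ext z
    simp

theorem aff_ones {δ : Finset V} {v : V} : X.Aff δ v ones :=
  ⟨0, 1, by simp⟩

theorem Aff.change {δ : Finset V} {v v' : V} {f : V ⊕ D → ℤ} (hf : X.Aff δ v f)
    (hδ : X.IsFace δ ∅) (hv : v ∈ δ) (hv' : v' ∈ δ) : X.Aff δ v' f := by
  obtain ⟨m, c, hm⟩ := hf
  have hsub : {v', v} ⊆ δ := by
    intro a ha
    simp only [mem_insert, mem_singleton] at ha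
    rcases ha with rfl | rfl <;> assumption
  obtain ⟨φ, h1, h2⟩ := X.exists_transition
    (X.isFace_mono hδ hsub subset_rfl (insert_nonempty _ _))
  refine ⟨m ∘ₗ φ, m (X.vec v (Sum.inl v')) + c, fun z hz => ?_⟩
  rw [hm z hz]
  rcases z with w | y
  · rw [h1 w]
    · simp [ones]; ring
    · refine X.isFace_mono hz ?_ subset_rfl (insert_nonempty _ _)
      intro a ha
      simp only [mem_insert, mem_singleton] at ha
      rcases ha with rfl | rfl | rfl <;> simp [*]
  · rw [h2 y]
    · simp [ones]
    · exact X.isFace_mono hz hsub subset_rfl (insert_nonempty _ _)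

theorem exists_aff {δ : Finset V} (hδ : X.IsFace δ ∅) {w : V} (hw : w ∈ δ) :
    ∃ f : V ⊕ D → ℤ, X.Aff δ w f ∧ ∀ w' ∈ δ, f (Sum.inl w') = if w' = w then 1 else 0 := by
  obtain ⟨m, hm⟩ := X.exists_functional hδ hw fun _ => -1
  refine ⟨fun z => m (X.vec w z) + 1 * ones z, ⟨m, 1, fun z _ => rfl⟩, fun w' hw' => ?_⟩
  split_ifs with h
  · subst h; simp [X.vec_self, ones]
  · simp [hm w' hw' h, ones]

/-! relations -/

theorem rayClass_eq_zero {δ : Finset V} {z : V ⊕ D} (h : ¬ X.IsRay δ z) (hδ : X.IsFace δ ∅) :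
    X.rayClass δ z = 0 := by
  rw [rayClass, Ideal.Quotient.mkₐ_eq_mk, Ideal.Quotient.eq_zero_iff_mem]
  refine Ideal.subset_span (Or.inl ⟨{z}, ?_, by simp⟩)
  rintro ⟨h1, h2⟩
  apply h
  rcases z with w | y
  · refine ⟨fun hw => ?_, ?_⟩
    · exact Finset.disjoint_left.1 h1 hw (by simp)
    · refine X.isFace_mono h2 ?_ (by simp) (insert_nonempty _ _)
      intro a; simp; tauto
  · refine X.isFace_mono h2 ?_ (by simp) (X.nonempty_of_isFace hδ)
    intro a; simp

theorem rayClass_mul_eq_zero {γ : Finset V} {v : V} {z : V ⊕ D} (hv : v ∉ γ) (hz : z ≠ Sum.inl v)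
    (h : ¬ X.IsRay (insert v γ) z) :
    X.rayClass γ z * X.rayClass γ (Sum.inl v) = 0 := by
  rw [rayClass, rayClass, ← map_mul, Ideal.Quotient.mkₐ_eq_mk, Ideal.Quotient.eq_zero_iff_mem]
  refine Ideal.subset_span (Or.inl ⟨{z, Sum.inl v}, ?_, ?_⟩)
  · rintro ⟨h1, h2⟩
    apply h
    rcases z with w | y
    · refine ⟨fun hw => ?_, ?_⟩
      · rw [mem_insert] at hw
        rcases hw with rfl | hw
        · exact hz rfl
        · exact Finset.disjoint_left.1 h1 hw (by simp)
      · refine X.isFace_mono h2 ?_ (by simp) (insert_nonempty _ _)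
        intro a; simp; tauto
    · refine X.isFace_mono h2 ?_ (by simp) (insert_nonempty _ _)
      intro a; simp; tauto
  · rw [Finset.prod_pair hz]

open Classical in
variable (X) in
/-- The class `∑_ρ f(ρ) x_ρ` in the Chow ring of `Σ^δ`. -/
def linClass (δ : Finset V) (f : V ⊕ D → ℤ) : X.Chow δ :=
  ∑ z with X.IsRay δ z, (f z : ℚ) • X.rayClass δ z

theorem linClass_sub (δ : Finset V) (f g : V ⊕ D → ℤ) :
    X.linClass δ (f - g) = X.linClass δ f - X.linClass δ g := by
  simp [linClass, sub_smul, Finset.sum_sub_distrib]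

theorem linClass_smul (δ : Finset V) (a : ℤ) (f : V ⊕ D → ℤ) :
    X.linClass δ (a • f) = (a : ℚ) • X.linClass δ f := by
  simp [linClass, Finset.smul_sum, mul_smul]

theorem linClass_sum (δ : Finset V) {ι : Type*} (s : Finset ι) (f : ι → V ⊕ D → ℤ) :
    X.linClass δ (∑ i ∈ s, f i) = ∑ i ∈ s, X.linClass δ (f i) := by
  simp only [linClass, Finset.sum_apply, Int.cast_sum, Finset.sum_smul]
  rw [Finset.sum_comm]

theorem mk_linearForm {v : V} (δ : Finset V) (m : N v →ₗ[ℤ] ℤ) :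
    Ideal.Quotient.mkₐ ℚ (X.chowIdeal δ) (X.linearForm δ m) =
      X.linClass δ (fun z => m (X.vec v z)) := by
  simp only [linearForm, linClass, map_sum, map_smul]
  rfl

theorem linClass_eq_zero {δ : Finset V} {v : V} (hv : v ∈ δ) (hδ : X.IsFace δ ∅)
    {f : V ⊕ D → ℤ} (hf : X.Aff δ v f) (h0 : ∀ w ∈ δ, f (Sum.inl w) = 0) :
    X.linClass δ f = 0 := by
  obtain ⟨m, c, hm⟩ := hf
  have hst : ∀ w ∈ δ, X.Star δ (Sum.inl w) := fun w hw => by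
    simpa [Star, insert_eq_of_mem hw] using hδ
  have hc : c = 0 := by
    have := hm _ (hst v hv)
    rw [h0 v hv, X.vec_self] at this
    simpa [ones] using this.symm
  subst hc
  have : X.linClass δ f = X.linClass δ (fun z => m (X.vec v z)) := by
    classical
    refine Finset.sum_congr rfl fun z hz => ?_
    rw [mem_filter] at hz
    rw [hm z hz.2.star]; simp
  rw [this, ← mk_linearForm, Ideal.Quotient.mkₐ_eq_mk, Ideal.Quotient.eq_zero_iff_mem]
  refine Ideal.subset_span (Or.inr ⟨v, hv, m, fun w hw => ?_, rfl⟩)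
  have := hm _ (hst w hw)
  rw [h0 w hw] at this
  simpa using this.symm

theorem linClass_congr {δ : Finset V} {v v' : V} (hv : v ∈ δ) (hv' : v' ∈ δ) (hδ : X.IsFace δ ∅)
    {f g : V ⊕ D → ℤ} (hf : X.Aff δ v f) (hg : X.Aff δ v' g)
    (h0 : ∀ w ∈ δ, f (Sum.inl w) = g (Sum.inl w)) :
    X.linClass δ f = X.linClass δ g := by
  rw [← sub_eq_zero, ← linClass_sub]
  exact linClass_eq_zero hv hδ (hf.sub (hg.change hδ hv' hv)) fun w hw => by simp [h0 w hw]

/-! restriction and Gysin -/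

open Classical in
/-- The value of the restriction map on the generators.  For the ray of `Σ^γ` corresponding
to `δ` itself, that is `z = Sum.inl w` with `δ = γ ∪ {w}`, one chooses an integral linear form `m`
which vanishes on `γ` and takes the value `1` on this ray, and the image is `-∑ m(e_ρ) x_ρ`, sum over
the rays of `Σ^δ`.  Any other ray goes to the corresponding ray of `Σ^δ`, or to `0` if there is
none. -/
def restrictionGen {γ δ : Finset V} (h : X.Facet γ δ) : V ⊕ D → X.Chow δ :=
  Sum.elim
    (fun w => if w ∈ δ \ γ then
      -Ideal.Quotient.mkₐ ℚ (X.chowIdeal δ)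
        (X.linearForm δ h.exists_functional.choose_spec.2.choose)
      else X.rayClass δ (Sum.inl w))
    fun y => X.rayClass δ (Sum.inr y)

open Classical in
/-- Lifts to `A^•(Σ^γ)` of the generators of `A^•(Σ^δ)`. -/
def gysinGen (X : UnimodularComplex V D N) (γ δ : Finset V) : V ⊕ D → X.Chow γ :=
  Sum.elim (fun w => if w ∈ δ then 0 else X.rayClass γ (Sum.inl w))
    fun y => X.rayClass γ (Sum.inr y)

/-- For a facet `γ` of `δ`, the element `x_ρ` of `A^1(Σ^γ)` for the ray `ρ` of `Σ^γ` corresponding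
to `δ`. -/
def edgeClass (X : UnimodularComplex V D N) (γ δ : Finset V) : X.Chow γ :=
  ∏ v ∈ δ \ γ, X.rayClass γ (Sum.inl v)

theorem Facet.restriction_aff {γ δ : Finset V} (h : X.Facet γ δ) : ∃ v ∈ γ, ∃ f : V ⊕ D → ℤ,
    X.Aff γ v f ∧ (∀ w ∈ γ, f (Sum.inl w) = 0) ∧ (∀ w ∈ δ \ γ, f (Sum.inl w) = 1) ∧
    ∀ w ∈ δ \ γ, restrictionGen h (Sum.inl w) = - X.linClass δ f := by
  have h1 := h.exists_functional.choose_spec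
  have h2 := h1.2.choose_spec
  refine ⟨_, h1.1, fun z => h1.2.choose (X.vec _ z), ⟨h1.2.choose, 0, fun z _ => ?_⟩,
    h2.1, h2.2, ?_⟩
  · simp
  · intro w hw
    simp only [restrictionGen, Sum.elim_inl, if_pos hw, mk_linearForm]

theorem restrictionGen_of_ne {γ : Finset V} {v : V} (h : X.Facet γ (insert v γ))
    {z : V ⊕ D} (hz : z ≠ Sum.inl v) (hv : v ∉ γ) :
    restrictionGen h z = X.rayClass (insert v γ) z := by
  rcases z with w | y
  · simp only [restrictionGen, Sum.elim_inl]
    rw [if_neg]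
    intro hw
    rw [mem_sdiff, mem_insert] at hw
    rcases hw.1 with rfl | h'
    · exact hz rfl
    · exact hw.2 h'
  · rfl

theorem aeval_restrictionGen {γ δ : Finset V} (h : X.Facet γ δ) :
    ∀ p ∈ X.chowIdeal γ, MvPolynomial.aeval (R := ℚ) (restrictionGen h) p = 0 := by
  intro p hp
  rw [← RingHom.mem_ker]
  revert p
  change X.chowIdeal γ ≤ _
  rw [chowIdeal, Ideal.span_le]
  obtain ⟨v, hv, rfl⟩ := h.exists_eq
  have hδ := h.2.2
  have hsd : v ∈ insert v γ \ γ := by simp [hv]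
  rintro p (⟨S, hS, rfl⟩ | ⟨v₁, hv₁, m, hm, rfl⟩)
  · rw [SetLike.mem_coe, RingHom.mem_ker, map_prod]
    simp only [MvPolynomial.aeval_X]
    by_cases hex : ∃ z ∈ S, z ≠ Sum.inl v ∧ ¬ X.IsRay (insert v γ) z
    · obtain ⟨z, hzS, hzv, hz⟩ := hex
      refine Finset.prod_eq_zero hzS ?_
      rw [restrictionGen_of_ne h hzv hv, rayClass_eq_zero hz hδ]
    · push Not at hex
      have hprod : ∏ z ∈ S.erase (Sum.inl v), restrictionGen h z = 0 := by
        have : ∏ z ∈ S.erase (Sum.inl v), restrictionGen h z =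
            ∏ z ∈ S.erase (Sum.inl v), X.rayClass (insert v γ) z :=
          Finset.prod_congr rfl fun z hz => restrictionGen_of_ne h (ne_of_mem_erase hz) hv
        rw [this]
        simp only [rayClass]
        rw [← map_prod, Ideal.Quotient.mkₐ_eq_mk, Ideal.Quotient.eq_zero_iff_mem]
        refine Ideal.subset_span (Or.inl ⟨_, ?_, rfl⟩)
        rintro ⟨h1, h2⟩
        apply hS
        refine ⟨?_, ?_⟩
        · rw [Finset.disjoint_left]
          intro a ha haS
          have hav : a ≠ v := fun e => hv (e ▸ ha)
          refine Finset.disjoint_left.1 h1 (mem_insert_of_mem ha) ?_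
          simpa [hav] using haS
        · refine X.isFace_mono h2 ?_ ?_ (h.1.mono subset_union_left)
          · intro a
            by_cases e : a = v
            · simp [e]
            · simp [e]
          · intro a; simp
      by_cases hvS : Sum.inl v ∈ S
      · rw [← Finset.mul_prod_erase _ _ hvS, hprod, mul_zero]
      · rw [Finset.erase_eq_of_notMem hvS] at hprod
        exact hprod
  · classical
    obtain ⟨v₀, hv₀, f, hf, hf0, hf1, hfr⟩ := h.restriction_aff
    have hδγ : γ ⊆ insert v γ := subset_insert _ _
    have hm' : X.Aff γ v₁ (fun z => m (X.vec v₁ z)) := ⟨m, 0, by simp⟩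
    rw [SetLike.mem_coe, RingHom.mem_ker]
    simp only [linearForm, map_sum, map_smul, MvPolynomial.aeval_X]
    have hray : X.IsRay γ (Sum.inl v) := ⟨hv, hδ⟩
    rw [← Finset.add_sum_erase _ _ (mem_filter.2 ⟨mem_univ _, hray⟩)]
    have : ∑ z ∈ (univ.filter (X.IsRay γ)).erase (Sum.inl v),
        (m (X.vec v₁ z) : ℚ) • restrictionGen h z =
        X.linClass (insert v γ) (fun z => m (X.vec v₁ z)) := by
      symm
      refine Finset.sum_subset_zero_on_sdiff ?_ ?_ ?_
      · intro z hz
        simp only [mem_filter, mem_univ, true_and, mem_erase] at hz ⊢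
        rcases z with w | y
        · obtain ⟨h1, h2⟩ := hz
          simp only [mem_insert, not_or] at h1
          refine ⟨fun e => h1.1 (Sum.inl_injective e), h1.2, ?_⟩
          exact X.isFace_mono h2 (insert_subset_insert _ hδγ) subset_rfl (insert_nonempty _ _)
        · exact ⟨by simp, X.isFace_mono hz hδγ subset_rfl h.1⟩
      · intro z hz
        simp only [mem_sdiff, mem_filter, mem_univ, true_and, mem_erase] at hz
        rw [restrictionGen_of_ne h hz.1.1 hv, rayClass_eq_zero hz.2 hδ, smul_zero]
      · intro z hz
        simp only [mem_filter, mem_univ, true_and] at hz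
        rw [restrictionGen_of_ne h ?_ hv]
        rintro rfl
        exact hz.1 (mem_insert_self _ _)
    rw [this, hfr v hsd, smul_neg, ← linClass_smul, neg_add_eq_zero]
    refine linClass_congr (mem_insert_of_mem hv₀) (mem_insert_of_mem hv₁) hδ
      ((hf.mono h.1 hδγ).smul _) (hm'.mono h.1 hδγ) fun w hw => ?_
    rw [mem_insert] at hw
    rcases hw with rfl | hw
    · simp [hf1 _ hsd]
    · simp [hf0 w hw, hm w hw]

/-- The restriction map `i^* : A^•(Σ^γ) → A^•(Σ^δ)` for a facet `γ` of `δ`; it is the ring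
homomorphism given by `restrictionGen`, and `H^k(γ) → H^k(δ)` is its homogeneous part. -/
def restriction {γ δ : Finset V} (h : X.Facet γ δ) : X.Chow γ →ₐ[ℚ] X.Chow δ :=
  Ideal.Quotient.liftₐ _ (MvPolynomial.aeval (restrictionGen h)) (aeval_restrictionGen h)

theorem edgeClass_insert {γ : Finset V} {v : V} (hv : v ∉ γ) :
    X.edgeClass γ (insert v γ) = X.rayClass γ (Sum.inl v) := by
  rw [edgeClass, Finset.insert_sdiff_of_notMem _ hv, Finset.sdiff_self]
  simp

theorem gysinGen_of_ne {γ : Finset V} {v : V} {z : V ⊕ D} (hz : z ≠ Sum.inl v)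
    (hγ : X.IsFace γ ∅) :
    X.gysinGen γ (insert v γ) z = X.rayClass γ z := by
  rcases z with w | y
  · simp only [gysinGen, Sum.elim_inl]
    split_ifs with hw
    · rw [mem_insert] at hw
      rcases hw with rfl | hw
      · exact absurd rfl hz
      · rw [rayClass_eq_zero _ hγ]
        exact fun h => h.1 hw
    · rfl
  · rfl

theorem aeval_gysinGen {γ δ : Finset V} (h : X.Facet γ δ) :
    ∀ p ∈ X.chowIdeal δ,
      MvPolynomial.aeval (R := ℚ) (X.gysinGen γ δ) p * X.edgeClass γ δ = 0 := by
  intro p hp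
  suffices h : X.chowIdeal δ ≤ Ideal.comap (MvPolynomial.aeval (R := ℚ) (X.gysinGen γ δ))
      (LinearMap.ker (LinearMap.toSpanSingleton (X.Chow γ) (X.Chow γ) (X.edgeClass γ δ))) by
    exact h hp
  rw [chowIdeal, Ideal.span_le]
  obtain ⟨v, hv, rfl⟩ := h.exists_eq
  have hδ := h.2.2
  have hγ := h.isFace
  rintro p (⟨S, hS, rfl⟩ | ⟨v₁, hv₁, m, hm, rfl⟩)
  · rw [SetLike.mem_coe, Ideal.mem_comap, LinearMap.mem_ker, LinearMap.toSpanSingleton_apply,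
      smul_eq_mul]
    rw [map_prod, edgeClass_insert hv]
    simp only [MvPolynomial.aeval_X]
    by_cases hvS : Sum.inl v ∈ S
    · rw [Finset.prod_eq_zero hvS, zero_mul]
      simp [gysinGen]
    · have : ∏ z ∈ S, X.gysinGen γ (insert v γ) z = ∏ z ∈ S, X.rayClass γ z :=
        Finset.prod_congr rfl fun z hz => gysinGen_of_ne (fun e => hvS (e ▸ hz)) hγ
      rw [this, mul_comm, ← Finset.prod_insert hvS]
      simp only [rayClass]
      rw [← map_prod, Ideal.Quotient.mkₐ_eq_mk, Ideal.Quotient.eq_zero_iff_mem]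
      refine Ideal.subset_span (Or.inl ⟨_, ?_, rfl⟩)
      rintro ⟨h1, h2⟩
      apply hS
      refine ⟨?_, ?_⟩
      · rw [Finset.disjoint_left] at h1 ⊢
        intro a ha haS
        rw [mem_insert] at ha
        rcases ha with rfl | ha
        · exact hvS (by simpa using haS)
        · exact h1 ha (by simpa using Or.inr (by simpa using haS))
      · refine X.isFace_mono h2 ?_ ?_ ((insert_nonempty _ _).mono subset_union_left)
        · intro a; simp
        · intro a; simp
  · classical
    rw [SetLike.mem_coe, Ideal.mem_comap, LinearMap.mem_ker, LinearMap.toSpanSingleton_apply,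
      smul_eq_mul]
    rw [edgeClass_insert hv]
    simp only [linearForm, map_sum, map_smul, MvPolynomial.aeval_X]
    obtain ⟨w₀, hw₀⟩ := h.1
    have hw₀' : w₀ ∈ insert v γ := mem_insert_of_mem hw₀
    have hst : ∀ w ∈ insert v γ, X.Star (insert v γ) (Sum.inl w) := fun w hw => by
      simpa [Star, insert_eq_of_mem hw] using hδ
    have hA : X.Aff (insert v γ) v₁ (fun z => m (X.vec v₁ z)) := ⟨m, 0, by simp⟩
    obtain ⟨m', c, hm'⟩ := hA.change hδ hv₁ hw₀'
    beta_reduce at hm'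
    have hc : c = 0 := by
      have := hm' _ (hst w₀ hw₀')
      rw [X.vec_self, hm w₀ hw₀'] at this
      simpa [ones] using this.symm
    subst hc
    simp only [zero_mul, add_zero] at hm'
    have key : X.linClass γ (fun z => m' (X.vec w₀ z)) = 0 := by
      refine linClass_eq_zero hw₀ hγ ⟨m', 0, by simp⟩ fun w hw => ?_
      have hw' : w ∈ insert v γ := mem_insert_of_mem hw
      rw [← hm' _ (hst w hw'), hm w hw']
    rw [← zero_mul (X.rayClass γ (Sum.inl v)), ← key, linClass, Finset.sum_mul, Finset.sum_mul]
    refine Finset.sum_subset_zero_on_sdiff ?_ ?_ ?_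
    · intro z hz
      simp only [mem_filter, mem_univ, true_and] at hz ⊢
      rcases z with w | y
      · obtain ⟨h1, h2⟩ := hz
        simp only [mem_insert, not_or] at h1
        exact ⟨h1.2, X.isFace_mono h2 (insert_subset_insert _ (subset_insert _ _)) subset_rfl
          (insert_nonempty _ _)⟩
      · exact X.isFace_mono hz (subset_insert _ _) subset_rfl h.1
    · intro z hz
      simp only [mem_sdiff, mem_filter, mem_univ, true_and] at hz
      by_cases hzv : z = Sum.inl v
      · subst hzv
        have hv' : v ∈ insert v γ := mem_insert_self _ _
        rw [← hm' _ (hst v hv'), hm v hv']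
        simp
      · rw [smul_mul_assoc, rayClass_mul_eq_zero hv hzv hz.2, smul_zero]
    · intro z hz
      simp only [mem_filter, mem_univ, true_and] at hz
      rw [← hm' z hz.star, gysinGen_of_ne ?_ hγ]
      rintro rfl
      exact hz.1 (mem_insert_self _ _)

/-- The Gysin map `A^•(Σ^δ) → A^{•+1}(Σ^γ)` for a facet `γ` of `δ`: it sends the class of a monomial
`∏ x_z` to the class of `(∏ x_z) x_ρ`, where `ρ` is the ray of `Σ^γ` corresponding to `δ`. It is
the map `H^k(δ) → H^{k+2}(γ)` Poincaré dual to the restriction. -/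
def gysin {γ δ : Finset V} (h : X.Facet γ δ) : X.Chow δ →ₗ[ℚ] X.Chow γ :=
  ((X.chowIdeal δ).restrictScalars ℚ).liftQ
    (LinearMap.mulRight ℚ (X.edgeClass γ δ) ∘ₗ
      (MvPolynomial.aeval (R := ℚ) (X.gysinGen γ δ)).toLinearMap)
    (fun p hp => aeval_gysinGen h p hp)

theorem restriction_rayClass {γ δ : Finset V} (h : X.Facet γ δ) (z : V ⊕ D) :
    restriction h (X.rayClass γ z) = restrictionGen h z := by
  exact MvPolynomial.aeval_X _ _

theorem gysin_mk {γ δ : Finset V} (h : X.Facet γ δ) (p : MvPolynomial (V ⊕ D) ℚ) :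
    gysin h (Ideal.Quotient.mkₐ ℚ (X.chowIdeal δ) p) =
      MvPolynomial.aeval (R := ℚ) (X.gysinGen γ δ) p * X.edgeClass γ δ := rfl


open Classical in
/-- Auxiliary: extended generators, with a class also for the vertices of `δ` itself. -/
def phiGen {δ : Finset V} (hδ : X.IsFace δ ∅) : V ⊕ D → X.Chow δ :=
  Sum.elim
    (fun w => if hw : w ∈ δ then -X.linClass δ (exists_aff hδ hw).choose
      else X.rayClass δ (Sum.inl w))
    fun y => X.rayClass δ (Sum.inr y)

theorem phiGen_of_aff {δ : Finset V} (hδ : X.IsFace δ ∅) {v w : V} (hw : w ∈ δ) (hv : v ∈ δ)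
    {f : V ⊕ D → ℤ} (hf : X.Aff δ v f)
    (h : ∀ w' ∈ δ, f (Sum.inl w') = if w' = w then 1 else 0) :
    phiGen hδ (Sum.inl w) = -X.linClass δ f := by
  simp only [phiGen, Sum.elim_inl, dif_pos hw]
  have h1 := (exists_aff hδ hw).choose_spec
  rw [linClass_congr hw hv hδ h1.1 hf fun w' hw' => by rw [h1.2 w' hw', h w' hw']]

theorem phiGen_of_notMem {δ : Finset V} (hδ : X.IsFace δ ∅) {z : V ⊕ D}
    (hz : ∀ w ∈ δ, z ≠ Sum.inl w) : phiGen hδ z = X.rayClass δ z := by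
  rcases z with w | y
  · simp only [phiGen, Sum.elim_inl]
    rw [dif_neg]
    exact fun hw => hz w hw rfl
  · rfl

theorem phiGen_eq_zero {δ : Finset V} (hδ : X.IsFace δ ∅) {w : V} (hw : w ∉ δ)
    (h : ¬ X.IsFace (insert w δ) ∅) : phiGen hδ (Sum.inl w) = 0 := by
  rw [phiGen_of_notMem, rayClass_eq_zero _ hδ]
  · exact fun h' => h h'.2
  · rintro w' hw' e
    exact hw (Sum.inl_injective e ▸ hw')

/-- Auxiliary: the Chow ring of `Σ^δ` as a quotient of one polynomial ring for all `δ`. -/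
def phi {δ : Finset V} (hδ : X.IsFace δ ∅) : MvPolynomial (V ⊕ D) ℚ →ₐ[ℚ] X.Chow δ :=
  MvPolynomial.aeval (phiGen hδ)

theorem phi_X {δ : Finset V} (hδ : X.IsFace δ ∅) (z : V ⊕ D) :
    phi hδ (MvPolynomial.X z) = phiGen hδ z := MvPolynomial.aeval_X _ _

theorem phi_surjective {δ : Finset V} (hδ : X.IsFace δ ∅) : Function.Surjective (phi hδ) := by
  classical
  intro y
  obtain ⟨p, rfl⟩ := Ideal.Quotient.mkₐ_surjective ℚ (X.chowIdeal δ) y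
  let g : V ⊕ D → MvPolynomial (V ⊕ D) ℚ :=
    fun z => if ∀ w ∈ δ, z ≠ Sum.inl w then MvPolynomial.X z else 0
  refine ⟨MvPolynomial.aeval g p, ?_⟩
  have : (phi hδ).comp (MvPolynomial.aeval g) = Ideal.Quotient.mkₐ ℚ (X.chowIdeal δ) := by
    refine MvPolynomial.algHom_ext fun z => ?_
    rw [AlgHom.comp_apply, MvPolynomial.aeval_X]
    change _ = X.rayClass δ z
    by_cases hz : ∀ w ∈ δ, z ≠ Sum.inl w
    · simp only [g, if_pos hz]
      rw [phi_X, phiGen_of_notMem hδ hz]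
    · simp only [g, if_neg hz, map_zero]
      push Not at hz
      obtain ⟨w, hw, rfl⟩ := hz
      rw [rayClass_eq_zero _ hδ]
      exact fun h => h.1 hw
  exact DFunLike.congr_fun this p

theorem sum_phiGen {δ : Finset V} (hδ : X.IsFace δ ∅) :
    ∑ w : V, phiGen hδ (Sum.inl w) = 0 := by
  classical
  obtain ⟨v, hv⟩ := X.nonempty_of_isFace hδ
  have h1 : ∑ w ∈ univ \ δ, phiGen hδ (Sum.inl w) = X.linClass δ ones := by
    rw [linClass, Finset.sum_filter, Fintype.sum_sum_type]
    have : ∑ y : D, (if X.IsRay δ (Sum.inr y) then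
        ((ones (Sum.inr y : V ⊕ D) : ℤ) : ℚ) • X.rayClass δ (Sum.inr y) else 0) = 0 :=
      Finset.sum_eq_zero fun y _ => by simp [ones]
    rw [this, add_zero]
    refine Finset.sum_subset_zero_on_sdiff (subset_univ _) ?_ ?_
    · intro w hw
      have hw' : w ∈ δ := by simpa using hw
      rw [if_neg]
      exact fun h => h.1 hw'
    · intro w hw
      have hw' : w ∉ δ := by simpa using hw
      rw [phiGen_of_notMem]
      · split_ifs with h
        · simp [ones]
        · exact rayClass_eq_zero h hδ
      · rintro w' hw'' e
        exact hw' (Sum.inl_injective e ▸ hw'')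
  rw [← Finset.sum_sdiff (subset_univ δ), h1, ← Finset.sum_attach δ]
  have h2 : ∀ w : δ, ∃ f, X.Aff δ v f ∧
      (∀ w' ∈ δ, f (Sum.inl w') = if w' = w then 1 else 0) := fun w => by
    obtain ⟨f, hf, hf'⟩ := exists_aff hδ w.2
    exact ⟨f, hf.change hδ w.2 hv, hf'⟩
  choose f hf hf' using h2
  rw [Finset.sum_congr rfl fun w _ => phiGen_of_aff hδ w.2 hv (hf w) (hf' w),
    Finset.sum_neg_distrib, ← linClass_sum, ← sub_eq_add_neg, ← linClass_sub]
  refine linClass_eq_zero hv hδ (aff_ones.sub (Aff.sum _ fun w _ => hf w)) fun w hw => ?_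
  simp only [Pi.sub_apply, Finset.sum_apply]
  rw [Finset.sum_congr rfl fun w' _ => hf' w' w hw]
  rw [Finset.sum_eq_single ⟨w, hw⟩]
  · simp [ones]
  · rintro ⟨b, hb⟩ _ hne
    rw [if_neg]
    rintro rfl
    exact hne rfl
  · simp

theorem linClass_restriction {γ : Finset V} {v : V} (hv : v ∉ γ) (h : X.Facet γ (insert v γ))
    (f : V ⊕ D → ℤ) :
    restriction h (X.linClass γ f) =
      X.linClass (insert v γ) f + (f (Sum.inl v) : ℚ) • restrictionGen h (Sum.inl v) := by
  classical
  have hδ := h.2.2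
  have hray : X.IsRay γ (Sum.inl v) := ⟨hv, hδ⟩
  simp only [linClass, map_sum, map_smul, restriction_rayClass]
  rw [← Finset.sum_erase_add _ _ (mem_filter.2 ⟨mem_univ _, hray⟩)]
  congr 1
  symm
  refine Finset.sum_subset_zero_on_sdiff ?_ ?_ ?_
  · intro z hz
    simp only [mem_filter, mem_univ, true_and, mem_erase] at hz ⊢
    rcases z with w | y
    · obtain ⟨h1, h2⟩ := hz
      simp only [mem_insert, not_or] at h1
      refine ⟨fun e => h1.1 (Sum.inl_injective e), h1.2, ?_⟩
      exact X.isFace_mono h2 (insert_subset_insert _ (subset_insert _ _)) subset_rfl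
        (insert_nonempty _ _)
    · exact ⟨by simp, X.isFace_mono hz (subset_insert _ _) subset_rfl h.1⟩
  · intro z hz
    simp only [mem_sdiff, mem_filter, mem_univ, true_and, mem_erase] at hz
    rw [restrictionGen_of_ne h hz.1.1 hv, rayClass_eq_zero hz.2 hδ, smul_zero]
  · intro z hz
    simp only [mem_filter, mem_univ, true_and] at hz
    rw [restrictionGen_of_ne h ?_ hv]
    rintro rfl
    exact hz.1 (mem_insert_self _ _)

theorem restriction_phi {γ δ : Finset V} (h : X.Facet γ δ) (p : MvPolynomial (V ⊕ D) ℚ) :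
    restriction h (phi h.isFace p) = phi h.2.2 p := by
  suffices (restriction h).comp (phi h.isFace) = phi h.2.2 from DFunLike.congr_fun this p
  refine MvPolynomial.algHom_ext fun z => ?_
  rw [AlgHom.comp_apply, phi_X, phi_X]
  obtain ⟨v, hv, rfl⟩ := h.exists_eq
  have hδ := h.2.2
  have hsd : v ∈ insert v γ \ γ := by simp [hv]
  obtain ⟨v₀, hv₀, f, hf, hf0, hf1, hfr⟩ := h.restriction_aff
  have hsub : γ ⊆ insert v γ := subset_insert _ _
  by_cases hz : ∀ w ∈ insert v γ, z ≠ Sum.inl w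
  · rw [phiGen_of_notMem _ hz, phiGen_of_notMem _ fun w hw => hz w (hsub hw),
      restriction_rayClass, restrictionGen_of_ne h (hz v (mem_insert_self _ _)) hv]
  push Not at hz
  obtain ⟨w, hw, rfl⟩ := hz
  by_cases hwv : w = v
  · subst hwv
    rw [phiGen_of_notMem, restriction_rayClass, hfr _ hsd,
      phiGen_of_aff hδ hw (hsub hv₀) (hf.mono h.1 hsub)]
    · intro w' hw'
      rw [mem_insert] at hw'
      rcases hw' with rfl | hw'
      · simp [hf1 _ hsd]
      · rw [hf0 w' hw', if_neg]
        rintro rfl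
        exact hv hw'
    · rintro w' hw' e
      exact hv (Sum.inl_injective e ▸ hw')
  · have hwγ : w ∈ γ := (mem_insert.1 hw).resolve_left hwv
    obtain ⟨g, hg, hg'⟩ := exists_aff h.isFace hwγ
    rw [phiGen_of_aff _ hwγ hwγ hg hg', map_neg, linClass_restriction hv, hfr v hsd, smul_neg,
      ← linClass_smul, ← sub_eq_add_neg, ← linClass_sub]
    symm
    refine phiGen_of_aff hδ hw hw (Aff.sub (hg.mono h.1 hsub) ?_) ?_
    · exact ((hf.mono h.1 hsub).change hδ (hsub hv₀) hw).smul _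
    · intro w' hw'
      rw [mem_insert] at hw'
      rcases hw' with rfl | hw'
      · simp [hf1 _ hsd, Ne.symm hwv]
      · simp [hf0 w' hw', hg' w' hw']

theorem gysin_restriction {γ δ : Finset V} (h : X.Facet γ δ) (y : X.Chow γ) :
    gysin h (restriction h y) = y * X.edgeClass γ δ := by
  classical
  obtain ⟨v, hv, rfl⟩ := h.exists_eq
  have hsd : v ∈ insert v γ \ γ := by simp [hv]
  obtain ⟨v₀, hv₀, f, hf, hf0, hf1, hfr⟩ := h.restriction_aff
  have hv₀' : v₀ ∈ γ := hv₀
  set I := LinearMap.ker (LinearMap.toSpanSingleton (X.Chow γ) (X.Chow γ)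
    (X.edgeClass γ (insert v γ))) with hI
  have hII : ∀ a, a ∈ I ↔ a * X.edgeClass γ (insert v γ) = 0 := fun a => by
    rw [hI, LinearMap.mem_ker, LinearMap.toSpanSingleton_apply, smul_eq_mul]
  let ψ₀ : MvPolynomial (V ⊕ D) ℚ →ₐ[ℚ] X.Chow γ ⧸ (I : Ideal (X.Chow γ)) :=
    (Ideal.Quotient.mkₐ ℚ (I : Ideal (X.Chow γ))).comp
      (MvPolynomial.aeval (X.gysinGen γ (insert v γ)))
  let ψ : X.Chow (insert v γ) →ₐ[ℚ] X.Chow γ ⧸ (I : Ideal (X.Chow γ)) :=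
    Ideal.Quotient.liftₐ _ ψ₀ fun p hp => by
      change Ideal.Quotient.mk _ _ = 0
      rw [Ideal.Quotient.eq_zero_iff_mem, hII]
      exact aeval_gysinGen h p hp
  have hray : ∀ z, ψ (X.rayClass _ z) =
      Ideal.Quotient.mk (I : Ideal (X.Chow γ)) (X.gysinGen γ (insert v γ) z) := fun z => by
    change ψ₀ (MvPolynomial.X z) = _
    simp [ψ₀]
  have hγ := h.isFace
  have hcomp : (ψ.comp (restriction h)).comp (Ideal.Quotient.mkₐ ℚ (X.chowIdeal γ)) =
      (Ideal.Quotient.mkₐ ℚ (I : Ideal (X.Chow γ))).comp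
        (Ideal.Quotient.mkₐ ℚ (X.chowIdeal γ)) := by
    refine MvPolynomial.algHom_ext fun z => ?_
    change ψ (restriction h (X.rayClass γ z)) =
      Ideal.Quotient.mk (I : Ideal (X.Chow γ)) (X.rayClass γ z)
    rw [restriction_rayClass]
    by_cases hz : z = Sum.inl v
    · subst hz
      rw [hfr v hsd, map_neg, linClass, map_sum]
      have hfz : X.linClass γ f = 0 := linClass_eq_zero hv₀ hγ hf hf0
      have hrv : X.IsRay γ (Sum.inl v) := ⟨hv, h.2.2⟩
      rw [linClass, ← Finset.add_sum_erase _ _ (mem_filter.2 ⟨mem_univ _, hrv⟩), hf1 v hsd] at hfz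
      rw [Int.cast_one, one_smul] at hfz
      rw [eq_neg_of_add_eq_zero_left hfz, map_neg, map_sum]
      congr 1
      refine Finset.sum_subset_zero_on_sdiff ?_ ?_ ?_
      · intro z hz
        simp only [mem_filter, mem_univ, true_and, mem_erase] at hz ⊢
        rcases z with w | y
        · obtain ⟨h1, h2⟩ := hz
          simp only [mem_insert, not_or] at h1
          refine ⟨fun e => h1.1 (Sum.inl_injective e), h1.2, ?_⟩
          exact X.isFace_mono h2 (insert_subset_insert _ (subset_insert _ _)) subset_rfl
            (insert_nonempty _ _)
        · exact ⟨by simp, X.isFace_mono hz (subset_insert _ _) subset_rfl h.1⟩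
      · intro z hz
        simp only [mem_sdiff, mem_filter, mem_univ, true_and, mem_erase] at hz
        rw [Ideal.Quotient.eq_zero_iff_mem, hII, edgeClass_insert hv, smul_mul_assoc,
          rayClass_mul_eq_zero hv hz.1.1 hz.2, smul_zero]
      · intro z hz
        simp only [mem_filter, mem_univ, true_and] at hz
        have hzv : z ≠ Sum.inl v := by
          rintro rfl
          exact hz.1 (mem_insert_self _ _)
        rw [map_smul, hray, gysinGen_of_ne hzv hγ]
        rfl
    · rw [restrictionGen_of_ne h hz hv, hray, gysinGen_of_ne hz hγ]
  obtain ⟨q, rfl⟩ := Ideal.Quotient.mkₐ_surjective ℚ (X.chowIdeal γ) y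
  have h1 := DFunLike.congr_fun hcomp q
  obtain ⟨r, hr⟩ := Ideal.Quotient.mkₐ_surjective ℚ (X.chowIdeal (insert v γ))
    (restriction h (Ideal.Quotient.mkₐ ℚ (X.chowIdeal γ) q))
  rw [← hr, gysin_mk, ← sub_eq_zero, ← sub_mul, ← hII, ← Ideal.Quotient.eq]
  change ψ (restriction h (Ideal.Quotient.mkₐ ℚ (X.chowIdeal γ) q)) = _ at h1
  rw [← hr] at h1
  exact h1

theorem gysin_phi {γ : Finset V} {v : V} (hv : v ∉ γ) (h : X.Facet γ (insert v γ))
    (p : MvPolynomial (V ⊕ D) ℚ) :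
    gysin h (phi h.2.2 p) = phi h.isFace (p * MvPolynomial.X (Sum.inl v)) := by
  rw [← restriction_phi h, gysin_restriction, edgeClass_insert hv, map_mul, phi_X,
    phiGen_of_notMem]
  rintro w hw e
  exact hv (Sum.inl_injective e ▸ hw)

variable (X)

/-- The sign `sign(γ, δ)` of a facet `γ` of `δ`, for the orientations which differ by the signs
`o γ`, `o δ` from the reference orientations given by the order of the vertices (every choice of
orientations of the simplices is of this form). -/
def sign (o : Finset V → ℤˣ) (γ δ : Finset V) : ℤˣ :=
  o γ * o δ * ∏ v ∈ δ \ γ, (-1) ^ #{w ∈ δ | v < w}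

open Classical in
/-- The sum over all pairs (facet `γ` of `δ`) of the signed restriction maps. -/
def restrictionTotal (o : Finset V → ℤˣ) : (∀ δ, X.Chow δ) →ₗ[ℚ] (∀ δ, X.Chow δ) :=
  LinearMap.pi fun δ => ∑ γ, if h : X.Facet γ δ then
    (sign o γ δ : ℤ) • ((restriction h).toLinearMap ∘ₗ LinearMap.proj γ) else 0

open Classical in
/-- The sum over all pairs (facet `γ` of `δ`) of the signed Gysin maps. -/
def gysinTotal (o : Finset V → ℤˣ) : (∀ δ, X.Chow δ) →ₗ[ℚ] (∀ δ, X.Chow δ) :=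
  LinearMap.pi fun γ => ∑ δ, if h : X.Facet γ δ then
    (sign o γ δ : ℤ) • (gysin h ∘ₗ LinearMap.proj δ) else 0

/-- The face `δ` contributes to `ST_1^{a,b} = ⊕_{s ≥ |a|, s ≡ a mod 2} ST_1^{a,b,s}`: it is a bounded
face and its dimension `s = #δ - 1` satisfies `s ≥ |a|` and `s ≡ a mod 2`. -/
def Occurs (a : ℤ) (δ : Finset V) : Prop :=
  X.IsFace δ ∅ ∧ |a| ≤ (#δ : ℤ) - 1 ∧ (#δ : ℤ) - 1 ≡ a [ZMOD 2]

open Classical in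
/-- Keep the components of the faces contributing to `ST_1^{a,•}`, and put `0` for the others. -/
def truncation (a : ℤ) : (∀ δ, X.Chow δ) →ₗ[ℚ] (∀ δ, X.Chow δ) :=
  LinearMap.pi fun δ => if X.Occurs a δ then LinearMap.proj δ else 0

open Classical in
/-- `ST_1^{a,b}`, the direct sum of the groups `H^{a+b-s}(δ)` over the bounded faces `δ` of dimension
`s ≥ |a|`, `s ≡ a mod 2`.  It is realized as the space of families indexed by all `δ` which vanish
for the other `δ`. -/
def steenbrink (a b : ℤ) : Submodule ℚ (∀ δ, X.Chow δ) :=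
  Submodule.pi Set.univ fun δ =>
    if X.Occurs a δ then X.cohomology δ (a + b - ((#δ : ℤ) - 1)) else ⊥

variable {X}

theorem mem_steenbrink {a b : ℤ} {x : ∀ δ, X.Chow δ} : x ∈ X.steenbrink a b ↔
    (∀ δ, X.Occurs a δ → x δ ∈ X.cohomology δ (a + b - ((#δ : ℤ) - 1))) ∧
      ∀ δ, ¬ X.Occurs a δ → x δ = 0 := by
  classical
  simp only [steenbrink, Submodule.mem_pi, Set.mem_univ, true_implies]
  constructor
  · intro h
    exact ⟨fun δ hδ => by simpa [hδ] using h δ, fun δ hδ => by simpa [hδ] using h δ⟩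
  · intro h δ
    split_ifs with hδ
    · exact h.1 δ hδ
    · exact h.2 δ hδ

theorem truncation_apply_of_occurs {a : ℤ} {δ : Finset V} (h : X.Occurs a δ)
    (x : ∀ δ, X.Chow δ) : X.truncation a x δ = x δ := by
  simp [truncation, h]

theorem truncation_apply_of_not {a : ℤ} {δ : Finset V} (h : ¬ X.Occurs a δ)
    (x : ∀ δ, X.Chow δ) : X.truncation a x δ = 0 := by
  simp [truncation, h]

theorem restriction_mem {γ δ : Finset V} (h : X.Facet γ δ) {k : ℤ} {y : X.Chow γ}
    (hy : y ∈ X.cohomology γ k) : restriction h y ∈ X.cohomology δ k := by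
  suffices X.cohomology γ k ≤ (X.cohomology δ k).comap (restriction h).toLinearMap from this hy
  refine iSup₂_le fun j hj => ?_
  rintro _ ⟨p, hp, rfl⟩
  refine Submodule.mem_iSup_of_mem j (Submodule.mem_iSup_of_mem hj ?_)
  have hgen : ∀ z, ∃ q ∈ homogeneousSubmodule (V ⊕ D) ℚ 1,
      Ideal.Quotient.mkₐ ℚ (X.chowIdeal δ) q = restrictionGen h z := by
    intro z
    rcases z with w | y
    · simp only [restrictionGen, Sum.elim_inl]
      split_ifs
      · refine ⟨-X.linearForm δ h.exists_functional.choose_spec.2.choose, ?_, map_neg _ _⟩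
        refine Submodule.neg_mem _ (Submodule.sum_mem _ fun z _ => Submodule.smul_mem _ _ ?_)
        exact isHomogeneous_X ℚ z
      · exact ⟨_, isHomogeneous_X ℚ _, rfl⟩
    · exact ⟨_, isHomogeneous_X ℚ _, rfl⟩
  choose g hg hg' using hgen
  refine ⟨aeval g p, ?_, ?_⟩
  · have := (show p.IsHomogeneous j from hp).aeval (n := 1) g hg
    simpa using this
  · change Ideal.Quotient.mkₐ ℚ (X.chowIdeal δ) (aeval g p) = aeval (restrictionGen h) p
    rw [← AlgHom.comp_apply, comp_aeval]
    simp only [hg']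

theorem gysin_mem {γ δ : Finset V} (h : X.Facet γ δ) {k : ℤ} {y : X.Chow δ}
    (hy : y ∈ X.cohomology δ k) : gysin h y ∈ X.cohomology γ (k + 2) := by
  suffices X.cohomology δ k ≤ (X.cohomology γ (k + 2)).comap (gysin h) from this hy
  refine iSup₂_le fun j hj => ?_
  rintro _ ⟨p, hp, rfl⟩
  refine Submodule.mem_iSup_of_mem (j + 1) (Submodule.mem_iSup_of_mem (by push_cast; omega) ?_)
  have hgen : ∀ z, ∃ q ∈ homogeneousSubmodule (V ⊕ D) ℚ 1,
      Ideal.Quotient.mkₐ ℚ (X.chowIdeal γ) q = X.gysinGen γ δ z := by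
    intro z
    rcases z with w | y
    · simp only [gysinGen, Sum.elim_inl]
      split_ifs
      · exact ⟨0, Submodule.zero_mem _, map_zero _⟩
      · exact ⟨_, isHomogeneous_X ℚ _, rfl⟩
    · exact ⟨_, isHomogeneous_X ℚ _, rfl⟩
  choose g hg hg' using hgen
  obtain ⟨v, hv, rfl⟩ := h.exists_eq
  refine ⟨aeval g p * MvPolynomial.X (Sum.inl v), ?_, ?_⟩
  · have := (show p.IsHomogeneous j from hp).aeval (n := 1) g hg
    rw [one_mul] at this
    exact this.mul (isHomogeneous_X ℚ _)
  · change Ideal.Quotient.mkₐ ℚ (X.chowIdeal γ) (aeval g p * MvPolynomial.X (Sum.inl v)) =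
      aeval (X.gysinGen γ _) p * X.edgeClass γ _
    rw [map_mul, ← AlgHom.comp_apply, comp_aeval, edgeClass_insert hv]
    simp only [hg']
    rfl

theorem Facet.card {γ δ : Finset V} (h : X.Facet γ δ) : #δ = #γ + 1 := by
  obtain ⟨v, hv, rfl⟩ := h.exists_eq
  exact card_insert_of_notMem hv

theorem restrictionPart_mem (o : Finset V → ℤˣ) {a a' b : ℤ} (ha : a + 1 = a')
    {x : ∀ δ, X.Chow δ} (hx : x ∈ X.steenbrink a b) :
    (X.truncation a' ∘ₗ X.restrictionTotal o) x ∈ X.steenbrink a' b := by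
  classical
  rw [mem_steenbrink] at hx ⊢
  refine ⟨fun δ hδ => ?_, fun δ hδ => by
    rw [LinearMap.comp_apply, truncation_apply_of_not hδ]⟩
  rw [LinearMap.comp_apply, truncation_apply_of_occurs hδ]
  simp only [restrictionTotal, LinearMap.pi_apply, LinearMap.sum_apply]
  refine Submodule.sum_mem _ fun γ _ => ?_
  split_ifs with h
  · rw [LinearMap.smul_apply]
    refine zsmul_mem ?_ _
    simp only [LinearMap.comp_apply, LinearMap.proj_apply]
    by_cases hγ : X.Occurs a γ
    · have := restriction_mem h (hx.1 γ hγ)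
      have e : a + b - ((#γ : ℤ) - 1) = a' + b - ((#δ : ℤ) - 1) := by
        rw [h.card]; push_cast; omega
      rwa [e] at this
    · rw [hx.2 γ hγ, map_zero]
      exact Submodule.zero_mem _
  · exact Submodule.zero_mem _

theorem gysinPart_mem (o : Finset V → ℤˣ) {a a' b : ℤ} (ha : a + 1 = a')
    {x : ∀ δ, X.Chow δ} (hx : x ∈ X.steenbrink a b) :
    (X.truncation a' ∘ₗ X.gysinTotal o) x ∈ X.steenbrink a' b := by
  classical
  rw [mem_steenbrink] at hx ⊢
  refine ⟨fun δ hδ => ?_, fun δ hδ => by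
    rw [LinearMap.comp_apply, truncation_apply_of_not hδ]⟩
  rw [LinearMap.comp_apply, truncation_apply_of_occurs hδ]
  simp only [gysinTotal, LinearMap.pi_apply, LinearMap.sum_apply]
  refine Submodule.sum_mem _ fun γ _ => ?_
  split_ifs with h
  · rw [LinearMap.smul_apply]
    refine zsmul_mem ?_ _
    simp only [LinearMap.comp_apply, LinearMap.proj_apply]
    by_cases hγ : X.Occurs a γ
    · have := gysin_mem h (hx.1 γ hγ)
      have e : a + b - ((#γ : ℤ) - 1) + 2 = a' + b - ((#δ : ℤ) - 1) := by
        rw [h.card]; push_cast; omega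
      rwa [e] at this
    · rw [hx.2 γ hγ, map_zero]
      exact Submodule.zero_mem _
  · exact Submodule.zero_mem _

theorem truncation_mem {a b : ℤ} {x : ∀ δ, X.Chow δ} (hx : x ∈ X.steenbrink a (b + 2)) :
    X.truncation (a + 2) x ∈ X.steenbrink (a + 2) b := by
  classical
  rw [mem_steenbrink] at hx ⊢
  refine ⟨fun δ hδ => ?_, fun δ hδ => truncation_apply_of_not hδ _⟩
  rw [truncation_apply_of_occurs hδ]
  by_cases h : X.Occurs a δ
  · have := hx.1 δ h
    have e : a + (b + 2) - ((#δ : ℤ) - 1) = a + 2 + b - ((#δ : ℤ) - 1) := by ring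
    rwa [e] at this
  · rw [hx.2 δ h]
    exact Submodule.zero_mem _

/-! square zero -/

/-- Auxiliary: remove the vertex `v` if it is there, and add it otherwise. -/
def flip (β : Finset V) (v : V) : Finset V := if v ∈ β then β.erase v else insert v β

theorem mem_flip {β : Finset V} {v u : V} :
    u ∈ flip β v ↔ (u = v ∧ v ∉ β) ∨ (u ≠ v ∧ u ∈ β) := by
  unfold flip
  split_ifs with h
  · simp [h]
  · by_cases e : u = v <;> simp [e, h]

/-- Auxiliary: the sign of the pair `β`, `flip β v`. -/
def flipSign (o : Finset V → ℤˣ) (β : Finset V) (v : V) : ℤˣ :=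
  o β * o (flip β v) * (-1) ^ #{w ∈ β | v < w}

open Classical in
/-- Auxiliary: the factor appearing in the map from `β` to `flip β v`. -/
def flipPoly (D : Type u) (β : Finset V) (v : V) : MvPolynomial (V ⊕ D) ℚ :=
  if v ∈ β then MvPolynomial.X (Sum.inl v) else 1

open Classical in
variable (X) in
/-- Auxiliary: the component from `β` to `μ` of the sum of restriction and Gysin maps. -/
def dMap (o : Finset V → ℤˣ) (β μ : Finset V) : X.Chow β →ₗ[ℚ] X.Chow μ :=
  (if h : X.Facet β μ then (sign o β μ : ℤ) • (restriction h).toLinearMap else 0) +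
  if h : X.Facet μ β then (sign o μ β : ℤ) • gysin h else 0

theorem total_apply (o : Finset V → ℤˣ) (x : ∀ δ, X.Chow δ) (μ : Finset V) :
    (X.restrictionTotal o + X.gysinTotal o) x μ = ∑ β, X.dMap o β μ (x β) := by
  classical
  simp only [LinearMap.add_apply, Pi.add_apply, restrictionTotal, gysinTotal, LinearMap.pi_apply,
    LinearMap.sum_apply, ← Finset.sum_add_distrib, dMap]
  refine Finset.sum_congr rfl fun β _ => ?_
  congr 1 <;> split_ifs <;> rfl

theorem flip_facet {β : Finset V} (hβ : X.IsFace β ∅) {v : V} (hμ : X.IsFace (flip β v) ∅) :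
    X.Facet β (flip β v) ∨ X.Facet (flip β v) β := by
  by_cases hv : v ∈ β
  · right
    refine ⟨X.nonempty_of_isFace hμ, ?_, hβ⟩
    simp only [flip, if_pos hv]
    exact Finset.erase_covBy hv
  · left
    refine ⟨X.nonempty_of_isFace hβ, ?_, hμ⟩
    simp only [flip, if_neg hv]
    exact Finset.covBy_insert hv

theorem exists_flip {o : Finset V → ℤˣ} {β μ : Finset V} (h : X.dMap o β μ ≠ 0) :
    X.IsFace β ∅ ∧ X.IsFace μ ∅ ∧ ∃ v, μ = flip β v := by
  have : X.Facet β μ ∨ X.Facet μ β := by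
    by_contra! h'
    exact h (by simp [dMap, h'])
  rcases this with h | h
  · refine ⟨h.isFace, h.2.2, ?_⟩
    obtain ⟨v, hv, rfl⟩ := h.exists_eq
    exact ⟨v, by simp [flip, hv]⟩
  · refine ⟨h.2.2, h.isFace, ?_⟩
    obtain ⟨v, hv, rfl⟩ := h.exists_eq
    exact ⟨v, by simp [flip, hv]⟩

theorem dMap_phi (o : Finset V → ℤˣ) {β μ : Finset V} {v : V} (hμv : μ = flip β v)
    (hβ : X.IsFace β ∅) (hμ : X.IsFace μ ∅) (p : MvPolynomial (V ⊕ D) ℚ) :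
    X.dMap o β μ (phi hβ p) = (flipSign o β v : ℤ) • phi hμ (p * flipPoly D β v) := by
  classical
  subst hμv
  by_cases hv : v ∈ β
  · have hf : flip β v = β.erase v := by simp [flip, hv]
    have h : X.Facet (flip β v) β := by
      rcases flip_facet hβ hμ with h | h
      · exact absurd (h.2.1.1.le hv) (by simp [hf])
      · exact h
    have h' : ¬ X.Facet β (flip β v) := fun h' => absurd (h'.2.1.1.le hv) (by simp [hf])
    rw [dMap, dif_neg h', dif_pos h, zero_add, LinearMap.smul_apply]
    congr 1
    · have : β \ flip β v = {v} := by
        rw [hf]; ext u; simp [mem_sdiff]; constructor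
        · tauto
        · rintro rfl; exact ⟨hv, by tauto⟩
      simp only [sign, flipSign, this, prod_singleton]
      rw [mul_comm (o (flip β v))]
    · rw [flipPoly, if_pos hv]
      have hv' : v ∉ flip β v := by simp [hf]
      have hins : β = insert v (flip β v) := by rw [hf, insert_erase hv]
      generalize hγ : flip β v = γ at *
      subst hins
      exact gysin_phi hv' h p
  · have hf : flip β v = insert v β := by simp [flip, hv]
    have hv' : v ∈ flip β v := by simp [hf]
    have h : X.Facet β (flip β v) := by
      rcases flip_facet hβ hμ with h | h
      · exact h
      · exact absurd (h.2.1.1.le hv') hv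
    have h' : ¬ X.Facet (flip β v) β := fun h' => absurd (h'.2.1.1.le hv') hv
    rw [dMap, dif_pos h, dif_neg h', add_zero, LinearMap.smul_apply]
    congr 1
    · have : flip β v \ β = {v} := by
        rw [hf, insert_sdiff_of_notMem _ hv, sdiff_self]; rfl
      have h2 : #{w ∈ flip β v | v < w} = #{w ∈ β | v < w} := by
        rw [hf, filter_insert, if_neg (lt_irrefl v)]
      simp only [sign, flipSign, this, prod_singleton, h2]
    · rw [flipPoly, if_neg hv, mul_one]
      exact restriction_phi h p

theorem flip_comm (β : Finset V) (v w : V) : flip (flip β v) w = flip (flip β w) v := by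
  ext u
  simp only [mem_flip]
  by_cases h1 : u = v <;> by_cases h2 : u = w <;> by_cases h3 : v = w <;> simp_all

theorem flipSign_antisymm (o : Finset V → ℤˣ) (β : Finset V) {v w : V} (h : v ≠ w) :
    flipSign o β v * flipSign o (flip β v) w = -(flipSign o β w * flipSign o (flip β w) v) := by
  wlog hlt : v < w generalizing v w
  · rw [this h.symm (lt_of_le_of_ne (not_lt.1 hlt) h.symm), neg_neg]
  have h1 : #{u ∈ flip β v | w < u} = #{u ∈ β | w < u} := by
    congr 1
    ext u
    simp only [mem_filter, mem_flip]
    constructor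
    · rintro ⟨⟨rfl, -⟩ | h', h''⟩
      · exact absurd h'' hlt.le.not_gt
      · exact ⟨h'.2, h''⟩
    · rintro ⟨h', h''⟩
      exact ⟨Or.inr ⟨(hlt.trans h'').ne', h'⟩, h''⟩
  have h2 : ((-1 : ℤˣ)) ^ #{u ∈ flip β w | v < u} = -(-1) ^ #{u ∈ β | v < u} := by
    by_cases hw : w ∈ β
    · have : {u ∈ β | v < u} = insert w {u ∈ flip β w | v < u} := by
        ext u
        simp only [mem_filter, mem_insert, mem_flip]
        by_cases e : u = w
        · subst e; simp [hw, hlt]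
        · simp [e]
      rw [this, card_insert_of_notMem (by simp [mem_flip, hw]), pow_succ]
      simp
    · have : {u ∈ flip β w | v < u} = insert w {u ∈ β | v < u} := by
        ext u
        simp only [mem_filter, mem_insert, mem_flip]
        by_cases e : u = w
        · subst e; simp [hw, hlt]
        · simp [e]
      rw [this, card_insert_of_notMem (by simp [hw]), pow_succ]
      simp
  have ho : ∀ γ, o γ * o γ = 1 := fun γ => Int.units_mul_self _
  simp only [flipSign, h1, h2, flip_comm β v w]
  have e1 : o β * o (flip β v) * (-1) ^ #{w ∈ β | v < w} *
      (o (flip β v) * o (flip (flip β w) v) * (-1) ^ #{u ∈ β | w < u}) =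
      (o (flip β v) * o (flip β v)) * (o β * o (flip (flip β w) v) * (-1) ^ #{w ∈ β | v < w} *
        (-1) ^ #{u ∈ β | w < u}) := by
    simp only [mul_assoc, mul_comm, mul_left_comm]
  have e2 : o β * o (flip β w) * (-1) ^ #{w_1 ∈ β | w < w_1} *
      (o (flip β w) * o (flip (flip β w) v) * -(-1) ^ #{u ∈ β | v < u}) =
      -((o (flip β w) * o (flip β w)) * (o β * o (flip (flip β w) v) * (-1) ^ #{w ∈ β | v < w} *
        (-1) ^ #{u ∈ β | w < u})) := by
    rw [mul_neg, mul_neg, neg_inj]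
    simp only [mul_assoc, mul_comm, mul_left_comm]
  rw [e1, e2, ho, ho, neg_neg]

theorem flip_flip (β : Finset V) (v : V) : flip (flip β v) v = β := by
  ext u
  simp only [mem_flip]
  by_cases h1 : u = v <;> simp_all

theorem flipSign_flip (o : Finset V → ℤˣ) (β : Finset V) (v : V) :
    flipSign o β v * flipSign o (flip β v) v = 1 := by
  have h : {u ∈ flip β v | v < u} = {u ∈ β | v < u} := by
    ext u
    simp only [mem_filter, mem_flip]
    constructor
    · rintro ⟨⟨rfl, -⟩ | h', h''⟩
      · exact absurd h'' (lt_irrefl _)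
      · exact ⟨h'.2, h''⟩
    · rintro ⟨h', h''⟩
      exact ⟨Or.inr ⟨h''.ne', h'⟩, h''⟩
  have e : flipSign o β v = flipSign o (flip β v) v := by
    rw [flipSign, flipSign, flip_flip, h, mul_comm (o β)]
  rw [e, Int.units_mul_self]

theorem flipPoly_comm (β : Finset V) {v w : V} (h : v ≠ w) :
    flipPoly D β v * flipPoly D (flip β v) w = flipPoly D β w * flipPoly D (flip β w) v := by
  have h1 : (w ∈ flip β v) = (w ∈ β) := by simp [mem_flip, h.symm]
  have h2 : (v ∈ flip β w) = (v ∈ β) := by simp [mem_flip, h]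
  classical
  simp only [flipPoly, h1, h2]
  rw [mul_comm]

theorem flipPoly_flip (β : Finset V) (v : V) :
    flipPoly D β v * flipPoly D (flip β v) v = MvPolynomial.X (Sum.inl v) := by
  by_cases h : v ∈ β <;> simp [flipPoly, mem_flip, h]

theorem phi_mul_eq_zero {δ : Finset V} (hδ : X.IsFace δ ∅) {w : V} (hw : w ∉ δ)
    (h : ¬ X.IsFace (insert w δ) ∅) (p : MvPolynomial (V ⊕ D) ℚ) :
    phi hδ (p * MvPolynomial.X (Sum.inl w)) = 0 := by
  rw [map_mul, phi_X, phiGen_eq_zero hδ hw h, mul_zero]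

theorem dMap_eq_zero {o : Finset V → ℤˣ} {β μ : Finset V} (h : ¬ X.IsFace μ ∅) :
    X.dMap o β μ = 0 := by
  by_contra h'
  exact h (exists_flip h').2.1

theorem dMap_dMap_phi (o : Finset V → ℤˣ) {β μ δ : Finset V} {v w : V} (hμ : μ = flip β v)
    (hδμ : δ = flip μ w) (hβ : X.IsFace β ∅) (hδ : X.IsFace δ ∅) (hf : X.IsFace μ ∅)
    (p : MvPolynomial (V ⊕ D) ℚ) :
    X.dMap o μ δ (X.dMap o β μ (phi hβ p)) =
      ((flipSign o β v * flipSign o μ w : ℤˣ) : ℤ) •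
        phi hδ (p * (flipPoly D β v * flipPoly D μ w)) := by
  rw [dMap_phi o hμ hβ hf, map_zsmul, dMap_phi o hδμ hf hδ, smul_smul, Units.val_mul, mul_assoc]

theorem sum_dMap_self (o : Finset V → ℤˣ) {β : Finset V} (hβ : X.IsFace β ∅) (hc : 2 ≤ #β)
    (p : MvPolynomial (V ⊕ D) ℚ) :
    ∑ μ, X.dMap o μ β (X.dMap o β μ (phi hβ p)) = 0 := by
  classical
  have hinj : Function.Injective (flip β) := by
    intro v w h
    by_contra hne
    have h1 : v ∈ flip β v ↔ v ∈ flip β w := by rw [h]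
    simp only [mem_flip, true_and, ne_eq, not_true, false_and, or_false, hne, not_false_eq_true,
      true_and, false_or] at h1
    tauto
  have h1 : ∑ μ, X.dMap o μ β (X.dMap o β μ (phi hβ p)) =
      ∑ v, X.dMap o (flip β v) β (X.dMap o β (flip β v) (phi hβ p)) := by
    rw [← Finset.sum_image (f := fun μ => X.dMap o μ β (X.dMap o β μ (phi hβ p)))
      (fun v _ w _ e => hinj e)]
    symm
    refine Finset.sum_subset (subset_univ _) fun μ _ hμ => ?_
    by_cases h0 : X.dMap o β μ = 0
    · rw [h0]; simp
    · obtain ⟨-, -, v, rfl⟩ := exists_flip h0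
      exact absurd (mem_image_of_mem _ (mem_univ v)) hμ
  have h2 : ∀ v, X.dMap o (flip β v) β (X.dMap o β (flip β v) (phi hβ p)) =
      phi hβ (p * MvPolynomial.X (Sum.inl v)) := by
    intro v
    by_cases hf : X.IsFace (flip β v) ∅
    · rw [dMap_dMap_phi o rfl (flip_flip β v).symm hβ hβ hf, flipSign_flip, flipPoly_flip]
      simp
    · rw [dMap_eq_zero hf]
      by_cases hv : v ∈ β
      · refine absurd (X.isFace_mono hβ (erase_subset v β) subset_rfl ?_) (by simpa [flip, hv] using hf)
        rw [← card_pos, card_erase_of_mem hv]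
        omega
      · rw [phi_mul_eq_zero hβ hv (by simpa [flip, hv] using hf)]
        simp
  rw [h1, Finset.sum_congr rfl fun v _ => h2 v, ← map_sum, ← Finset.mul_sum, map_mul, map_sum]
  simp only [phi_X, sum_phiGen, mul_zero]

theorem dMap_dMap_eq_zero (o : Finset V → ℤˣ) {β δ : Finset V} {v w : V} (hvne : v ≠ w)
    (hvw : δ = flip (flip β v) w) (hβ : X.IsFace β ∅) (hδ : X.IsFace δ ∅)
    (hc : #β = #δ → 2 ≤ #β) (hf1 : X.IsFace (flip β v) ∅) (hf2 : ¬ X.IsFace (flip β w) ∅)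
    (p : MvPolynomial (V ⊕ D) ℚ) :
    X.dMap o (flip β v) δ (X.dMap o β (flip β v) (phi hβ p)) = 0 := by
  have hδm : ∀ u, u ∈ δ ↔ (u = w ∧ (u = v ∧ v ∉ β ∨ u ≠ v ∧ u ∈ β → False)) ∨
      (u ≠ w ∧ (u = v ∧ v ∉ β ∨ u ≠ v ∧ u ∈ β)) := by
    intro u
    rw [hvw, mem_flip]
    constructor
    · rintro (⟨rfl, h⟩ | ⟨h, h'⟩)
      · exact Or.inl ⟨rfl, fun h' => h (mem_flip.2 h')⟩
      · exact Or.inr ⟨h, mem_flip.1 h'⟩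
    · rintro (⟨rfl, h⟩ | ⟨h, h'⟩)
      · exact Or.inl ⟨rfl, fun h' => h (mem_flip.1 h')⟩
      · exact Or.inr ⟨h, mem_flip.2 h'⟩
  by_cases hv : v ∈ β
  · by_cases hw : w ∈ β
    · -- both vertices are removed
      exfalso
      refine hf2 (X.isFace_mono hβ ?_ subset_rfl ?_)
      · intro u; rw [mem_flip]; rintro (⟨rfl, h⟩ | h)
        · exact absurd hw h
        · exact h.2
      · exact ⟨v, mem_flip.2 (Or.inr ⟨hvne, hv⟩)⟩
    · rw [dMap_dMap_phi o rfl hvw hβ hδ hf1]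
      have e1 : flipPoly D β v = MvPolynomial.X (Sum.inl v) := by simp [flipPoly, hv]
      have e2 : flipPoly D (flip β v) w = 1 := by
        rw [flipPoly, if_neg]
        rw [mem_flip]
        rintro (⟨h, -⟩ | ⟨-, h⟩)
        · exact hvne h.symm
        · exact hw h
      rw [e1, e2, mul_one, phi_mul_eq_zero hδ, smul_zero]
      · rw [hδm]; tauto
      · intro h
        apply hf2
        convert h using 1
        ext u
        rw [mem_flip, mem_insert, hδm]
        by_cases h1 : u = v <;> by_cases h2 : u = w <;> simp_all
  · by_cases hw : w ∈ β
    · exfalso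
      have hne : ¬ (flip β w).Nonempty := fun h => by
        refine hf2 (X.isFace_mono hβ ?_ subset_rfl h)
        intro u; rw [mem_flip]; rintro (⟨rfl, h⟩ | h)
        · exact absurd hw h
        · exact h.2
      rw [not_nonempty_iff_eq_empty] at hne
      have hβw : β = {w} := by
        rw [← flip_flip β w, hne]; simp [flip]
      have hδv : δ = {v} := by
        rw [hvw, flip_comm, hne]; simp [flip]
      have := hc (by rw [hβw, hδv]; simp)
      rw [hβw] at this
      simp at this
    · -- both vertices are added
      exfalso
      refine hf2 (X.isFace_mono hδ ?_ subset_rfl ?_)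
      · intro u; rw [mem_flip, hδm]
        by_cases h1 : u = v <;> by_cases h2 : u = w <;> simp_all
      · exact ⟨w, mem_flip.2 (Or.inl ⟨rfl, hw⟩)⟩

theorem sum_dMap_of_ne (o : Finset V → ℤˣ) {β δ : Finset V} (hβ : X.IsFace β ∅)
    (hδ : X.IsFace δ ∅) (hne : β ≠ δ) (hc : #β = #δ → 2 ≤ #β) (p : MvPolynomial (V ⊕ D) ℚ) :
    ∑ μ, X.dMap o μ δ (X.dMap o β μ (phi hβ p)) = 0 := by
  classical
  by_cases hex : ∃ v w, δ = flip (flip β v) w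
  swap
  · refine Finset.sum_eq_zero fun μ _ => ?_
    by_cases h0 : X.dMap o β μ = 0
    · rw [h0]; simp
    by_cases h1 : X.dMap o μ δ = 0
    · rw [h1]; simp
    obtain ⟨-, -, v, rfl⟩ := exists_flip h0
    obtain ⟨-, -, w, rfl⟩ := exists_flip h1
    exact absurd ⟨v, w, rfl⟩ hex
  obtain ⟨v, w, hvw⟩ := hex
  have hvne : v ≠ w := by
    rintro rfl
    rw [flip_flip] at hvw
    exact hne hvw.symm
  have hδ2 : δ = flip (flip β w) v := by rw [hvw, flip_comm]
  have hne' : flip β v ≠ flip β w := by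
    intro h
    have h1 : v ∈ flip β v ↔ v ∈ flip β w := by rw [h]
    simp only [mem_flip, true_and, ne_eq, not_true, false_and, or_false, hvne, not_false_eq_true,
      true_and, false_or] at h1
    tauto
  rw [← Finset.sum_subset (subset_univ {flip β v, flip β w}), Finset.sum_pair hne']
  · -- the two paths cancel
    by_cases hf1 : X.IsFace (flip β v) ∅ <;> by_cases hf2 : X.IsFace (flip β w) ∅
    · rw [dMap_dMap_phi o rfl hvw hβ hδ hf1, dMap_dMap_phi o rfl hδ2 hβ hδ hf2,
        flipSign_antisymm o β hvne, flipPoly_comm β hvne]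
      simp
    · rw [dMap_eq_zero hf2, dMap_dMap_eq_zero o hvne hvw hβ hδ hc hf1 hf2]
      simp
    · rw [dMap_eq_zero hf1, dMap_dMap_eq_zero o hvne.symm hδ2 hβ hδ hc hf2 hf1]
      simp
    · rw [dMap_eq_zero hf1, dMap_eq_zero hf2]
      simp
  · intro μ _ hμ
    by_cases h0 : X.dMap o β μ = 0
    · rw [h0]; simp
    by_cases h1 : X.dMap o μ δ = 0
    · rw [h1]; simp
    exfalso
    obtain ⟨-, -, v', rfl⟩ := exists_flip h0
    obtain ⟨-, -, w', hw'⟩ := exists_flip h1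
    have hv' : v' = v ∨ v' = w := by
      by_contra! hh
      have e1 : v' ∈ δ ↔ v' ∈ β := by rw [hvw]; simp [mem_flip, hh]
      have e2 : w' = v' := by
        by_contra hh2
        have : v' ∈ δ ↔ v' ∉ β := by rw [hw']; simp [mem_flip, Ne.symm hh2]
        tauto
      rw [e2, flip_flip] at hw'
      exact hne hw'.symm
    rcases hv' with rfl | rfl <;> simp at hμ

theorem sum_dMap (o : Finset V → ℤˣ) {β δ : Finset V} (hc : #β = #δ → 2 ≤ #β) (y : X.Chow β) :
    ∑ μ, X.dMap o μ δ (X.dMap o β μ y) = 0 := by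
  by_cases hβ : X.IsFace β ∅
  swap
  · refine Finset.sum_eq_zero fun μ _ => ?_
    have : X.dMap o β μ = 0 := by
      by_contra h
      exact hβ (exists_flip h).1
    rw [this]; simp
  by_cases hδ : X.IsFace δ ∅
  swap
  · refine Finset.sum_eq_zero fun μ _ => ?_
    rw [dMap_eq_zero hδ]; simp
  obtain ⟨p, rfl⟩ := phi_surjective hβ y
  by_cases e : β = δ
  · subst e
    exact sum_dMap_self o hβ (hc rfl) p
  · exact sum_dMap_of_ne o hβ hδ e hc p

theorem card_of_dMap_ne {o : Finset V → ℤˣ} {β μ : Finset V} (h : X.dMap o β μ ≠ 0) :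
    X.IsFace β ∅ ∧ X.IsFace μ ∅ ∧ (#μ = #β + 1 ∨ #β = #μ + 1) := by
  obtain ⟨h1, h2, v, rfl⟩ := exists_flip h
  refine ⟨h1, h2, ?_⟩
  rcases flip_facet h1 h2 with h | h
  · exact Or.inl h.card
  · exact Or.inr h.card

variable (X) in
/-- The differential `d = i^* + gys` with target `ST_1^{a',b}`. -/
def differential (o : Finset V → ℤˣ) (a' : ℤ) : (∀ δ, X.Chow δ) →ₗ[ℚ] (∀ δ, X.Chow δ) :=
  X.truncation a' ∘ₗ X.restrictionTotal o + X.truncation a' ∘ₗ X.gysinTotal o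

theorem differential_eq (o : Finset V → ℤˣ) (a' : ℤ) (x : ∀ δ, X.Chow δ) :
    X.differential o a' x = X.truncation a' ((X.restrictionTotal o + X.gysinTotal o) x) := by
  simp [differential]

theorem differential_mem (o : Finset V → ℤˣ) {a a' b : ℤ} (ha : a + 1 = a')
    {x : ∀ δ, X.Chow δ} (hx : x ∈ X.steenbrink a b) :
    X.differential o a' x ∈ X.steenbrink a' b :=
  Submodule.add_mem _ (restrictionPart_mem o ha hx) (gysinPart_mem o ha hx)

theorem differential_differential (o : Finset V → ℤˣ) {a b : ℤ} {x : ∀ δ, X.Chow δ}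
    (hx : x ∈ X.steenbrink a b) :
    X.differential o (a + 1 + 1) (X.differential o (a + 1) x) = 0 := by
  classical
  rw [mem_steenbrink] at hx
  funext δ
  rw [differential_eq o (a + 1 + 1)]
  by_cases hδ : X.Occurs (a + 1 + 1) δ
  swap
  · rw [truncation_apply_of_not hδ]; rfl
  rw [truncation_apply_of_occurs hδ, total_apply]
  have key : ∀ μ, X.dMap o μ δ (X.differential o (a + 1) x μ) =
      ∑ β, X.dMap o μ δ (X.dMap o β μ (x β)) := by
    intro μ
    rw [differential_eq]
    by_cases hμ : X.Occurs (a + 1) μ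
    · rw [truncation_apply_of_occurs hμ, total_apply, map_sum]
    rw [truncation_apply_of_not hμ, map_zero]
    symm
    refine Finset.sum_eq_zero fun β _ => ?_
    by_cases hβ : X.Occurs a β
    swap
    · rw [hx.2 β hβ]; simp
    by_cases h1 : X.dMap o β μ = 0
    · rw [h1]; simp
    by_cases h2 : X.dMap o μ δ = 0
    · rw [h2]; simp
    exfalso
    obtain ⟨-, h3, h4⟩ := card_of_dMap_ne h1
    obtain ⟨-, -, h5⟩ := card_of_dMap_ne h2
    obtain ⟨-, c1, c2⟩ := hβ
    obtain ⟨-, c3, c4⟩ := hδ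
    refine hμ ⟨h3, ?_, ?_⟩
    · rw [abs_le] at *
      omega
    · unfold Int.ModEq at *
      omega
  rw [Finset.sum_congr rfl fun μ _ => key μ, Finset.sum_comm]
  refine Finset.sum_eq_zero fun β _ => ?_
  by_cases hβ : X.Occurs a β
  swap
  · rw [hx.2 β hβ]; simp
  refine sum_dMap o (fun e => ?_) (x β)
  obtain ⟨-, c1, c2⟩ := hβ
  obtain ⟨-, c3, c4⟩ := hδ
  rw [abs_le] at *
  omega

theorem truncation_differential (o : Finset V → ℤˣ) {a b : ℤ} {x : ∀ δ, X.Chow δ}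
    (hx : x ∈ X.steenbrink a b) :
    X.truncation (a + 1 + 2) (X.differential o (a + 1) x) =
      X.differential o (a + 2 + 1) (X.truncation (a + 2) x) := by
  classical
  rw [mem_steenbrink] at hx
  funext δ
  have e : a + 2 + 1 = a + 1 + 2 := by ring
  rw [e, differential_eq, differential_eq]
  by_cases hδ : X.Occurs (a + 1 + 2) δ
  swap
  · rw [truncation_apply_of_not hδ, truncation_apply_of_not hδ]
  rw [truncation_apply_of_occurs hδ, truncation_apply_of_occurs hδ, total_apply]
  have key : ∀ β, X.dMap o β δ (x β) ≠ 0 → X.Occurs (a + 1) δ ∧ X.Occurs (a + 2) β := by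
    intro β h
    have h1 : X.dMap o β δ ≠ 0 := by rintro h'; rw [h'] at h; simp at h
    have hβ : X.Occurs a β := by
      by_contra h'
      rw [hx.2 β h'] at h; simp at h
    obtain ⟨h2, h3, h4⟩ := card_of_dMap_ne h1
    obtain ⟨-, c1, c2⟩ := hβ
    obtain ⟨-, c3, c4⟩ := hδ
    rw [abs_le] at c1 c3
    refine ⟨⟨h3, ?_, ?_⟩, ⟨h2, ?_, ?_⟩⟩
    · rw [abs_le]; omega
    · unfold Int.ModEq at *; omega
    · rw [abs_le]; omega
    · unfold Int.ModEq at *; omega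
  have hR : ∀ β, X.dMap o β δ (X.truncation (a + 2) x β) = X.dMap o β δ (x β) := by
    intro β
    by_cases h : X.Occurs (a + 2) β
    · rw [truncation_apply_of_occurs h]
    · rw [truncation_apply_of_not h, map_zero]
      by_contra h'
      exact h (key β (Ne.symm h')).2
  rw [Finset.sum_congr rfl fun β _ => hR β]
  by_cases h : X.Occurs (a + 1) δ
  · rw [truncation_apply_of_occurs h, total_apply]
  · rw [truncation_apply_of_not h]
    symm
    refine Finset.sum_eq_zero fun β _ => ?_
    by_contra h'
    exact h (key β h').1

variable (X)

/-- The cochain complex `(ST_1^{•,b}, d)`. -/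
def steenbrinkComplex (o : Finset V → ℤˣ) (b : ℤ) : CochainComplex (ModuleCat.{u} ℚ) ℤ where
  X a := ModuleCat.of ℚ (X.steenbrink a b)
  d i j := if h : i + 1 = j then
    ModuleCat.ofHom ((X.differential o j).restrict fun _ hx => differential_mem o h hx) else 0
  shape i j h := dif_neg h
  d_comp_d' i j k hij hjk := by
    obtain rfl : i + 1 = j := hij
    obtain rfl : i + 1 + 1 = k := hjk
    rw [dif_pos rfl, dif_pos rfl]
    refine ModuleCat.hom_ext (LinearMap.ext fun x => Subtype.ext ?_)
    exact differential_differential o x.2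

/-- The monodromy operator `N : ST_1^{•,p+2} → ST_1^{•,p}[2]`: the identity on `ST_1^{a,p+2,s}` if
`s ≥ |a+2|`, and zero otherwise. -/
def monodromy (o : Finset V → ℤˣ) (p : ℤ) :
    X.steenbrinkComplex o (p + 2) ⟶ (X.steenbrinkComplex o p)⟦(2 : ℤ)⟧ where
  f a := ModuleCat.ofHom
    ((X.truncation (a + 2)).restrict (p := X.steenbrink a (p + 2)) (q := X.steenbrink (a + 2) p)
      fun _ hx => truncation_mem hx)
  comm' i j hij := by
    obtain rfl : i + 1 = j := hij
    rw [CochainComplex.shiftFunctor_obj_d', Int.negOnePow_even 2 ⟨1, rfl⟩, one_smul]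
    have e : i + 2 + 1 = i + 1 + 2 := by ring
    simp only [steenbrinkComplex, dif_pos e]
    refine ModuleCat.hom_ext (LinearMap.ext fun x => Subtype.ext ?_)
    have := truncation_differential (X := X) o x.2
    rw [e] at this
    exact this.symm

variable (o : Finset V → ℤˣ) (p : ℤ)

/-- `K^{•,p+2}`, the kernel of the monodromy operator `N : ST_1^{•,p+2} → ST_1^{•,p}[2]`. -/
abbrev kernelComplex : CochainComplex (ModuleCat.{u} ℚ) ℤ := kernel (X.monodromy o p)

/-- `R^{•,p}`, the cokernel of `N : ST_1^{•,p+2}[-2] → ST_1^{•,p}`, that is, the shift by `-2` of the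
cokernel of `N : ST_1^{•,p+2} → ST_1^{•,p}[2]`. -/
abbrev cokernelComplex : CochainComplex (ModuleCat.{u} ℚ) ℤ :=
  (cokernel (X.monodromy o p))⟦(-2 : ℤ)⟧

/-- `Cone(N : ST_1^{•,p+2} → ST_1^{•,p}[2])[-1]`; in degree `a` it is
`ST_1^{a,p+2} ⊕ ST_1^{a+1,p}`. -/
abbrev shiftedCone : CochainComplex (ModuleCat.{u} ℚ) ℤ := mappingCocone (X.monodromy o p)

/-- The inclusion `K^{•,p+2} → ST_1^{•,p+2}`, viewed as a morphism `K^{•,p+2} → Cone(N)[-1]`. -/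
def kernelToCone : X.kernelComplex o p ⟶ X.shiftedCone o p :=
  mappingCocone.lift (X.monodromy o p) (kernel.ι (X.monodromy o p)) 0
    (by rw [δ_zero, zero_add, kernel.condition, Cochain.ofHom_zero])

theorem comp_rightShift_rightShift {C : Type*} [Category* C] [Abelian C]
    {K L Q : CochainComplex C ℤ} (φ : K ⟶ L) (q : L ⟶ Q) (h : φ ≫ q = 0) (h₁ : (2 : ℤ) + -2 = 0) (h₂ : (1 : ℤ) + 1 = 2) :
    δ 0 1 (0 : Cochain K ((Q⟦(-2 : ℤ)⟧)⟦(1 : ℤ)⟧) 0) + (Cochain.ofHom φ).comp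
      (((Cochain.ofHom q).rightShift (-2) 2 h₁).rightShift 1 1 h₂) (zero_add 1) = 0 := by
  rw [δ_zero, zero_add]
  ext i j hij
  rw [Cochain.zero_cochain_comp_v, Cochain.ofHom_v]
  rw [Cochain.rightShift_v _ _ _ _ _ _ _ (i + 2) (by lia),
    Cochain.rightShift_v _ _ _ _ _ _ _ i (by lia), Cochain.ofHom_v,
    ← Category.assoc, ← Category.assoc, ← HomologicalComplex.comp_f, h]
  simp only [HomologicalComplex.zero_f, zero_comp, Cochain.zero_v]

/-- The morphism `Cone(N)[-1] → R^{•,p}[1]` which is zero on the summand `ST_1^{a,p+2}`, and the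
projection `ST_1^{a+1,p} → R^{a+1,p}` on the other summand. -/
def coneToCokernel : X.shiftedCone o p ⟶ (X.cokernelComplex o p)⟦(1 : ℤ)⟧ :=
  mappingCocone.desc (X.monodromy o p) 0
    (((Cocycle.ofHom (cokernel.π (X.monodromy o p))).rightShift (-2) 2 (by norm_num)).rightShift
      1 1 (by norm_num))
    (comp_rightShift_rightShift _ _ (cokernel.condition _) (by norm_num) (by norm_num))

theorem lift_comp_desc {C : Type*} [Category* C] [Abelian C] {A K L Q : CochainComplex C ℤ}
    {φ : K ⟶ L} (i : A ⟶ K) (hi) (q : Cocycle L Q 1) (hq) :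
    mappingCocone.lift φ i 0 hi ≫ mappingCocone.desc φ 0 q hq = 0 := by
  ext n
  rw [HomologicalComplex.comp_f, ← Category.id_comp ((mappingCocone.desc φ 0 q hq).f n),
    ← mappingCocone.id_X φ n (n - 1) (by lia), Preadditive.add_comp, Preadditive.comp_add]
  simp

theorem kernelToCone_comp : X.kernelToCone o p ≫ X.coneToCokernel o p = 0 :=
  lift_comp_desc (φ := X.monodromy o p) _ _ _ _

/-- `T = Cone(K^{•,p+2} → Cone(N)[-1])[-1]`, the total complex of
`K^{•,p+2} → ST_1^{•,p+2} → ST_1^{•,p}`; in degree `a` it is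
`K^{a,p+2} ⊕ ST_1^{a-1,p+2} ⊕ ST_1^{a,p}`. -/
abbrev total : CochainComplex (ModuleCat.{u} ℚ) ℤ := mappingCocone (X.kernelToCone o p)

theorem comp_rightUnshift {C : Type*} [Category* C] [Abelian C]
    {K L Q : CochainComplex C ℤ} (φ : K ⟶ L) (q : L ⟶ Q⟦(1 : ℤ)⟧) (h : φ ≫ q = 0) (h₁ : (0 : ℤ) + 1 = 1) :
    δ 0 1 (0 : Cochain K Q 0) + (Cochain.ofHom φ).comp
      ((Cochain.ofHom q).rightUnshift 1 h₁) (zero_add 1) = 0 := by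
  rw [δ_zero, zero_add]
  rw [← Cochain.rightUnshift_comp _ _ (zero_add 0) 1 (zero_add 1),
    ← Cochain.ofHom_comp, h, Cochain.ofHom_zero, Cochain.rightUnshift_zero]

/-- The projection `π : T → R^{•,p}`: in each degree, the projection `ST_1^{a,p} → R^{a,p}` on the
last summand and zero on the others. -/
def totalToCokernel : X.total o p ⟶ X.cokernelComplex o p :=
  mappingCocone.desc (X.kernelToCone o p) 0
    ((Cocycle.ofHom (X.coneToCokernel o p)).rightUnshift 1 (zero_add 1))
    (comp_rightUnshift _ _ (X.kernelToCone_comp o p) (zero_add 1))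

end

end UnimodularComplex

open Pretriangulated in
/-- `T` is a distinguished triangle in the bounded derived category, viewed as the full triangulated
subcategory of the derived category of all the objects with bounded cohomology. -/
def IsBoundedDistinguished {C : Type*} [Category* C] [Abelian C] [HasDerivedCategory C]
    (T : Triangle (DerivedCategory C)) : Prop :=
  T ∈ distTriang (DerivedCategory C) ∧ DerivedCategory.TStructure.t.bounded T.obj₁ ∧
    DerivedCategory.TStructure.t.bounded T.obj₂ ∧ DerivedCategory.TStructure.t.bounded T.obj₃

end TropicalSteenbrink

open CategoryTheory CochainComplex Pretriangulated TropicalSteenbrink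

/-! Write `C` for the shifted cone of `N`. Assertion 1 holds for every morphism of complexes: its
cocone, source and target form a distinguished triangle in the derived category.

For assertion 2, the kernel and the cokernel of `N` give a sequence `0 → K → ST^{p+2} → ST^p[2] →
R[2] → 0` which is exact in each degree. The complex `T` is the total complex of the three terms `K
→ ST^{p+2} → ST^p[2]`. As this row is exact except at its last term, where the cokernel is `R[2]`,
the projection `π : T → R` is a quasi-isomorphism. This is `quasiIso_of_exact`, proved by a diagram
chase in an arbitrary abelian category and applied in `quasiIso_totalToCokernel`.

The cocone of `g : K → C` is `T`, so that `T → K → C → T[1]` is distinguished. Inverting `π` in the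
derived category replaces `T` by `R`: the first morphism becomes `f`, the inverse of `π` followed by
the projection `T → K`, and the last one becomes the connecting morphism `C → T[1]` followed by
`π[1]`. By `triangle_mor₃_comp` the latter is exactly `h`, with no sign.

The geometry enters only through two facts: `N` is a morphism of complexes, and `ST^{a,b}` vanishes
for large `|a|`. The second gives boundedness of the Steenbrink complexes, hence of `K`, then of `C`
and `T` by the triangles, and of `R` by means of `π`. -/

namespace CochainComplex.mappingCocone

open CategoryTheory Limits HomComplex HomologicalComplex

/-! ### Components and differential of a mapping cocone -/

section

variable {C : Type*} [Category* C] [Preadditive C] {K L : CochainComplex C ℤ} (φ : K ⟶ L)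
  [HasHomotopyCofiber φ]

/-- In this form the coboundary of the second projection can be computed by `δ_descCochain`. -/
theorem snd_eq_descCochain :
    snd φ = descCochain φ (0 : Cochain K L (-1)) (Cochain.ofHom (𝟙 L)) (by omega) := by
  ext p q hpq
  rw [← Category.id_comp ((snd φ).v p q hpq), ← Category.id_comp ((descCochain _ _ _ _).v p q hpq),
    ← id_X φ p q hpq]
  simp

/-- The cocone is the mapping cone shifted by `-1`, and this odd shift negates the differential,
whence the two signs. The formula unfolds the fact that the coboundary of the cochain `snd φ`, of
degree `-1`, is `-(fst φ ≫ φ)`. -/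
theorem d_snd_v (p q r : ℤ) (hpq : p + 1 = q) (hr : r + 1 = p) :
    (mappingCocone φ).d p q ≫ (snd φ).v q p (by omega) =
      -((fst φ).f p ≫ φ.f p) - (snd φ).v p r (by omega) ≫ L.d r p := by
  have h : δ (-1) 0 (snd φ) = -(Cochain.ofHom (fst φ ≫ φ)) := by
    rw [snd_eq_descCochain, δ_descCochain φ _ _ _ 1 (by omega)]
    simp [Cochain.ofHom_comp]
  have h' := Cochain.congr_v h p p (by omega)
  rw [δ_v (-1) 0 (by omega) _ p p (by omega) r q (by omega) hpq] at h'
  simp only [Int.negOnePow_zero, one_smul, Cochain.neg_v, Cochain.ofHom_v,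
    HomologicalComplex.comp_f] at h'
  rw [← h']
  abel

theorem ext_to {A : C} (p q : ℤ) (hpq : p + -1 = q) {x y : A ⟶ (mappingCocone φ).X p}
    (h₁ : x ≫ (fst φ).f p = y ≫ (fst φ).f p)
    (h₂ : x ≫ (snd φ).v p q hpq = y ≫ (snd φ).v p q hpq) : x = y := by
  rw [← Category.comp_id x, ← Category.comp_id y, ← id_X φ p q hpq]
  simp only [Preadditive.comp_add, reassoc_of% h₁, reassoc_of% h₂]


theorem desc_f {M : CochainComplex C ℤ} (α : Cochain K M 0) (β : Cocycle L M 1) (hαβ)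
    (p q : ℤ) (hpq : q + 1 = p) :
    (desc φ α β hαβ).f p = (fst φ).f p ≫ α.v p p (add_zero p) +
      (snd φ).v p q (by omega) ≫ β.1.v q p hpq := by
  rw [← Category.id_comp ((desc φ α β hαβ).f p), ← id_X φ p q (by omega)]
  simp

end

/-! ### The iterated cocone of `A ⟶ K ⟶ L` as a complex of triples -/

section

variable {C : Type*} [Category* C] [Preadditive C] {A K L : CochainComplex C ℤ} {φ : K ⟶ L}
  [HasHomotopyCofiber φ] (g : A ⟶ mappingCocone φ) [HasHomotopyCofiber g]

/-- The projection on the middle summand of the iterated cocone `A ⊞ K ⊞ L`. -/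
noncomputable def sndFst (n m : ℤ) (hm : m + 1 = n) : (mappingCocone g).X n ⟶ K.X m :=
  (snd g).v n m (by omega) ≫ (fst φ).f m

/-- The projection on the last summand of the iterated cocone `A ⊞ K ⊞ L`. -/
noncomputable def sndSnd (n m l : ℤ) (hm : m + 1 = n) (hl : l + 1 = m) :
    (mappingCocone g).X n ⟶ L.X l :=
  (snd g).v n m (by omega) ≫ (snd φ).v m l (by omega)

/-- Together with `ext_iterated_iff`, this allows generalized elements of the iterated cocone to be
handled as triples in `A ⊞ K ⊞ L`, in degrees `n`, `n - 1` and `n - 2`. -/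
theorem exists_iterated {Z : C} (n m l : ℤ) (hm : m + 1 = n) (hl : l + 1 = m)
    (α : Z ⟶ A.X n) (β : Z ⟶ K.X m) (γ : Z ⟶ L.X l) :
    ∃ x : Z ⟶ (mappingCocone g).X n, x ≫ (fst g).f n = α ∧
      x ≫ sndFst g n m hm = β ∧ x ≫ sndSnd g n m l hm hl = γ := by
  refine ⟨α ≫ (inl g).v n n (add_zero n) + (β ≫ (inl φ).v m m (add_zero m) +
    γ ≫ (inr φ).1.v l m hl) ≫ (inr g).1.v m n hm, ?_, ?_, ?_⟩ <;> simp [sndFst, sndSnd]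

theorem ext_iterated_iff {Z : C} (n m l : ℤ) (hm : m + 1 = n) (hl : l + 1 = m)
    {x y : Z ⟶ (mappingCocone g).X n} : x = y ↔ x ≫ (fst g).f n = y ≫ (fst g).f n ∧
      x ≫ sndFst g n m hm = y ≫ sndFst g n m hm ∧
      x ≫ sndSnd g n m l hm hl = y ≫ sndSnd g n m l hm hl := by
  refine ⟨by rintro rfl; simp, fun ⟨h₁, h₂, h₃⟩ =>
    ext_to g n m (by omega) h₁ (ext_to φ m l (by omega) ?_ ?_)⟩
  · simpa only [Category.assoc, sndFst] using h₂
  · simpa only [Category.assoc, sndSnd] using h₃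

variable {g} {i : A ⟶ K} (hgi : g ≫ fst φ = i)
  (hg : ∀ n m (h : n + -1 = m), g.f n ≫ (snd φ).v n m h = 0)

include hgi in
-- The projection `fst φ` is a morphism of complexes, so only the signs of the outer cocone appear.
theorem d_sndFst (n m n' : ℤ) (hm : m + 1 = n) (hn' : n + 1 = n') :
    (mappingCocone g).d n n' ≫ sndFst g n' n hn' =
      -((fst g).f n ≫ i.f n) - sndFst g n m hm ≫ K.d m n := by
  subst hgi
  rw [sndFst, ← Category.assoc, d_snd_v g n n' m hn' hm]
  simp [sndFst]

include hg in
-- The signs of the outer and of the inner cocone cancel. There is no contribution of `A`, since `g`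
-- has zero component on `L` by `hg`.
theorem d_sndSnd (n m l n' : ℤ) (hm : m + 1 = n) (hl : l + 1 = m) (hn' : n + 1 = n') :
    (mappingCocone g).d n n' ≫ sndSnd g n' n m hn' hm =
      sndFst g n m hm ≫ φ.f m + sndSnd g n m l hm hl ≫ L.d l m := by
  rw [sndSnd, ← Category.assoc, d_snd_v g n n' m hn' hm]
  simp [hg, d_snd_v φ m n l hm hl, sndFst, sndSnd, add_comm]

include hgi hg in
/-- The differential of the iterated cocone of `A ⟶ K ⟶ L`, in terms of the three summands. -/
theorem comp_d_eq_iff {Z : C} (n m l n' : ℤ) (hm : m + 1 = n) (hl : l + 1 = m) (hn' : n + 1 = n')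
    (x : Z ⟶ (mappingCocone g).X n) (y : Z ⟶ (mappingCocone g).X n') :
    x ≫ (mappingCocone g).d n n' = y ↔
      (x ≫ (fst g).f n) ≫ A.d n n' = y ≫ (fst g).f n' ∧
      -((x ≫ (fst g).f n) ≫ i.f n) - (x ≫ sndFst g n m hm) ≫ K.d m n = y ≫ sndFst g n' n hn' ∧
      (x ≫ sndFst g n m hm) ≫ φ.f m + (x ≫ sndSnd g n m l hm hl) ≫ L.d l m =
        y ≫ sndSnd g n' n m hn' hm := by
  rw [ext_iterated_iff g n' n m hn' hm, Category.assoc, Category.assoc, Category.assoc,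
    d_sndFst hgi n m n' hm hn', d_sndSnd hg n m l n' hm hl hn']
  simp

end

/-! ### Resolving a cokernel by the iterated cocone -/

section

variable {C : Type*} [Category* C] [Abelian C] {A K L R : CochainComplex C ℤ} {φ : K ⟶ L}
  {g : A ⟶ mappingCocone φ} {i : A ⟶ K}

/-- If `A` is the kernel of `φ : K ⟶ L` and `R` is its cokernel, placed in degree `2`, then the
total complex of `A ⟶ K ⟶ L` is quasi-isomorphic to `R`. -/
theorem quasiIso_of_exact (hgi : g ≫ fst φ = i)
    (hg : ∀ n m (h : n + -1 = m), g.f n ≫ (snd φ).v n m h = 0)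
    (hmono : ∀ n, Mono (i.f n))
    (hK : ∀ n ⦃Z : C⦄ (x : Z ⟶ K.X n), x ≫ φ.f n = 0 →
      ∃ (Z' : C) (e : Z' ⟶ Z) (_ : Epi e) (y : Z' ⟶ A.X n), e ≫ x = y ≫ i.f n)
    (q : Cocycle L R 2) (hepi : ∀ n m (h : n + 2 = m), Epi (q.1.v n m h))
    (hL : ∀ n m (h : n + 2 = m) ⦃Z : C⦄ (x : Z ⟶ L.X n), x ≫ q.1.v n m h = 0 →
      ∃ (Z' : C) (e : Z' ⟶ Z) (_ : Epi e) (y : Z' ⟶ K.X n), e ≫ x = y ≫ φ.f n)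
    (π : mappingCocone g ⟶ R)
    (hπ : ∀ n m l (hm : m + 1 = n) (hl : l + 1 = m),
      π.f n = sndSnd g n m l hm hl ≫ q.1.v l n (by omega)) :
    QuasiIso π := by
  -- The cocycle `q` has even degree, so it commutes with the differentials without a sign. For
  -- non-consecutive degrees both sides vanish.
  have hd (l m n n' : ℤ) (h : l + 2 = n) (h' : m + 2 = n') :
      L.d l m ≫ q.1.v m n' h' = q.1.v l n h ≫ R.d n n' := by
    by_cases hl : l + 1 = m
    · have := Cochain.congr_v (q.δ_eq_zero 3) l n' (by omega)
      rw [δ_v 2 3 (by omega) _ l n' (by omega) n m (by omega) (by omega),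
        Int.negOnePow_odd 3 ⟨1, rfl⟩, Cochain.zero_v, Units.neg_smul, one_smul,
        ← sub_eq_add_neg, sub_eq_zero] at this
      exact this.symm
    · rw [L.shape _ _ hl, R.shape _ _ (by simp; omega), zero_comp, comp_zero]
  refine ⟨fun n => ?_⟩
  rw [quasiIsoAt_iff_isIso_homologyMap]
  obtain ⟨m, hm⟩ : ∃ m, m + 1 = n := ⟨n - 1, by omega⟩
  obtain ⟨l, hl⟩ : ∃ l, l + 1 = m := ⟨m - 1, by omega⟩
  obtain ⟨k, hk⟩ : ∃ k, k + 1 = l := ⟨l - 1, by omega⟩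
  -- Injectivity. Let `x = (a, b, c)` be a cocycle whose image `q c` is the boundary of `y`; a
  -- primitive of `x` is sought. Elements are morphisms from a test object, and each lifting takes
  -- place after precomposition with an epimorphism `e₁`, `e₂`, `e₃`.
  have hmono' : Mono (homologyMap π n) := by
    rw [mono_homologyMap_iff_up_to_refinements π m n (n + 1) (by simp; omega) (by simp)]
    intro Z x hx y hy
    obtain ⟨-, h₂, h₃⟩ := (comp_d_eq_iff hgi hg n m l (n + 1) hm hl rfl x 0).1 hx
    rw [zero_comp] at h₂ h₃
    obtain ⟨Z₁, e₁, _, γ, hγ⟩ := surjective_up_to_refinements_of_epi (q.1.v k m (by omega)) y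
    -- With `γ` a lift of `y`, the element `c - dγ` dies in `R`, hence equals `φ β` for some `β`.
    have h₄ : (e₁ ≫ x ≫ sndSnd g n m l hm hl - γ ≫ L.d k l) ≫ q.1.v l n (by omega) = 0 := by
      rw [Preadditive.sub_comp, Category.assoc, Category.assoc, Category.assoc, ← hπ,
        hy, hd k l m n (by omega) (by omega), ← reassoc_of% hγ, sub_self]
    obtain ⟨Z₂, e₂, _, β, hβ⟩ := hL l n (by omega) _ h₄
    -- Here `φ(b + dβ) = φ b + d(c - dγ) = φ b + dc`, which is the last component of `dx = 0`. Hence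
    -- `b + dβ = i α` for some `α`.
    have h₅ : (e₂ ≫ e₁ ≫ x ≫ sndFst g n m hm + β ≫ K.d l m) ≫ φ.f m = 0 := by
      have h₆ : (β ≫ K.d l m) ≫ φ.f m = (e₂ ≫ e₁ ≫ x ≫ sndSnd g n m l hm hl) ≫ L.d l m := by
        rw [Category.assoc, ← φ.comm, ← reassoc_of% hβ]
        simp
      rw [Preadditive.add_comp, h₆]
      simpa using e₂ ≫= (e₁ ≫= h₃)
    obtain ⟨Z₃, e₃, _, α, hα⟩ := hK m _ h₅
    -- The primitive is `(-α, β, γ)`: its differential is `(-dα, iα - dβ, φβ + dγ)`, whose last two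
    -- entries are `b` and `c` by construction.
    obtain ⟨z, hz₁, hz₂, hz₃⟩ := exists_iterated g m l k hl hk (-α) (e₃ ≫ β) (e₃ ≫ e₂ ≫ γ)
    refine ⟨Z₃, e₃ ≫ e₂ ≫ e₁, inferInstance, z, ?_⟩
    symm
    rw [comp_d_eq_iff hgi hg m l k n hl hk hm, hz₁, hz₂, hz₃]
    refine ⟨?_, ?_, ?_⟩
    · have h₆ : x ≫ (fst g).f n ≫ i.f n = -(x ≫ sndFst g n m hm ≫ K.d m n) := by
        rw [neg_sub_left, neg_eq_zero, add_comm] at h₂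
        simpa only [Category.assoc] using eq_neg_of_add_eq_zero_left h₂
      rw [← cancel_mono (i.f n)]
      simp only [Category.assoc, ← i.comm, Preadditive.neg_comp, ← reassoc_of% hα, h₆]
      simp
    · rw [Preadditive.neg_comp, ← hα]
      simp
    · rw [Category.assoc, ← hβ]
      simp
  -- Surjectivity. Lift a cocycle `y` of `R` to `γ` in `L`. Then `dγ` dies in `R`, so `dγ = φ β`;
  -- next `φ(dβ) = d(dγ) = 0`, so `dβ = i α`.
  have hepi' : Epi (homologyMap π n) := by
    rw [epi_homologyMap_iff_up_to_refinements π m n (n + 1) (by simp; omega) (by simp)]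
    intro Z y hy
    obtain ⟨Z₁, e₁, _, γ, hγ⟩ := surjective_up_to_refinements_of_epi (q.1.v l n (by omega)) y
    obtain ⟨Z₂, e₂, _, β, hβ⟩ := hL m (n + 1) (by omega) (γ ≫ L.d l m) (by
      rw [Category.assoc, hd l m n (n + 1) (by omega) (by omega), ← reassoc_of% hγ, hy, comp_zero])
    obtain ⟨Z₃, e₃, _, α, hα⟩ := hK n (β ≫ K.d m n) (by
      rw [Category.assoc, ← φ.comm, ← reassoc_of% hβ]
      simp)
    -- The sign of `β` makes `(α, -β, γ)` a cocycle: its differential is `(dα, -iα + dβ, -φβ + dγ)`,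
    -- and `dα = 0` because `i` is a monomorphism and `d(iα) = d(dβ) = 0`.
    obtain ⟨z, hz₁, hz₂, hz₃⟩ := exists_iterated g n m l hm hl α (-(e₃ ≫ β)) (e₃ ≫ e₂ ≫ γ)
    refine ⟨Z₃, e₃ ≫ e₂ ≫ e₁, inferInstance, z, ?_, 0, ?_⟩
    · rw [comp_d_eq_iff hgi hg n m l (n + 1) hm hl rfl, hz₁, hz₂, hz₃]
      refine ⟨?_, ?_, ?_⟩
      · rw [← cancel_mono (i.f (n + 1)), Category.assoc, ← i.comm, ← reassoc_of% hα]
        simp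
      · rw [← hα]
        simp
      · simp only [Category.assoc, Preadditive.neg_comp, ← hβ]
        simp
    -- The image of the triple is `y` itself, so the correcting boundary is `0`.
    · rw [hπ n m l hm hl, reassoc_of% hz₃, zero_comp, add_zero, ← hγ]
      simp only [Category.assoc]
  exact isIso_of_mono_of_epi _

end

end CochainComplex.mappingCocone

/-! ### The connecting morphism of the cocone triangle -/

namespace CochainComplex.mappingCocone

open CategoryTheory Limits HomComplex

variable {C : Type*} [Category* C] [Preadditive C] [HasBinaryBiproducts C]
  {K L : CochainComplex C ℤ} (φ : K ⟶ L)

/-- Both sides are the inclusion of `L` into the mapping cone, followed by the canonical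
identification of the cone with its shift by `-1` and then by `1`. This identification carries no
sign. -/
theorem triangle_mor₃_f (n : ℤ) :
    (triangle φ).mor₃.f n = (inr φ).1.v n (n + 1) rfl := by
  have h : (inr φ).1.v n (n + 1) rfl = (mappingCone.inr φ).f n ≫
      ((mappingCone φ).shiftFunctorObjXIso (-1) (n + 1) n (by omega)).inv :=
    (Cochain.rightShift_v _ (-1) 1 (by omega) n (n + 1) rfl n (add_zero n)).trans
      (congrArg (· ≫ _) (Cochain.ofHom_v _ _))
  rw [h]
  change (mappingCone.inr φ).f n ≫
    ((CategoryTheory.shiftFunctorZero (CochainComplex C ℤ) ℤ).inv.app (mappingCone φ)).f n ≫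
    ((CategoryTheory.shiftFunctorAdd' (CochainComplex C ℤ) (-1) 1 0 (by omega)).hom.app
      (mappingCone φ)).f n = _
  rw [shiftFunctorAdd'_hom_app_f', shiftFunctorZero_inv_app_f]
  congr 1
  exact HomologicalComplex.XIsoOfEq_hom_comp_XIsoOfEq_hom _ _ _

/-- The connecting morphism is the inclusion of the summand `L`, on which the descended morphism
restricts to `h` up to the shift. This is what makes the third morphism of the final triangle equal
to `h`, and not merely `h` up to sign. -/
theorem triangle_mor₃_comp {R : CochainComplex C ℤ} (h : L ⟶ R⟦(1 : ℤ)⟧) (hα) :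
    (triangle φ).mor₃ ≫ (desc φ 0 ((Cocycle.ofHom h).rightUnshift 1 (zero_add 1)) hα)⟦(1 : ℤ)⟧' =
      h := by
  ext n
  have := inr_v_desc_f φ 0 ((Cocycle.ofHom h).rightUnshift 1 (zero_add 1)) hα n (n + 1) rfl
  rw [Cocycle.rightUnshift_coe, Cochain.rightUnshift_v _ _ _ _ _ _ _ (add_zero n),
    Cocycle.ofHom_coe, Cochain.ofHom_v, ← triangle_mor₃_f] at this
  exact this.trans (Category.comp_id _)

end CochainComplex.mappingCocone

/-! ### Replacing a vertex of the triangle by a quasi-isomorphic complex -/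

namespace DerivedCategory

open CategoryTheory Pretriangulated CochainComplex

variable {C : Type*} [Category* C] [Abelian C] [HasDerivedCategory C]

/-- Replacing the first vertex of the triangle of a mapping cocone by a quasi-isomorphic complex. -/
theorem mappingCocone_triangle_replace_distinguished {K L R : CochainComplex C ℤ} (φ : K ⟶ L)
    (π : mappingCocone φ ⟶ R) [QuasiIso π] (h : L ⟶ R⟦(1 : ℤ)⟧)
    (hπ : (mappingCocone.triangle φ).mor₃ ≫ π⟦(1 : ℤ)⟧' = h) :
    Triangle.mk (inv (Q.map π) ≫ Q.map (mappingCocone.fst φ)) (Q.map φ)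
      (Q.map h ≫ (Q.commShiftIso (1 : ℤ)).hom.app R) ∈ distTriang (DerivedCategory C) := by
  let e : Q.obj (mappingCocone φ) ≅ Q.obj R := @asIso _ _ _ _ (Q.map π) inferInstance
  refine isomorphic_distinguished _ (mappingCocone_triangle_distinguished φ) _
    (Iso.symm (Triangle.isoMk _ _ e (Iso.refl _) (Iso.refl _) ?_ ?_ ?_))
  · exact (Category.comp_id _).trans (IsIso.hom_inv_id_assoc (Q.map π) _).symm
  · exact (Category.comp_id _).trans (Category.id_comp _).symm
  -- The third square is the naturality in `π` of the isomorphism by which `Q` commutes with the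
  -- shift.
  · subst hπ
    have h₁ := Functor.commShiftIso_hom_naturality Q π (1 : ℤ)
    have h₂ := Q.map_comp (mappingCocone.triangle φ).mor₃ (π⟦(1 : ℤ)⟧')
    refine (Category.assoc _ _ _).trans ?_
    refine (congrArg (Q.map (mappingCocone.triangle φ).mor₃ ≫ ·) h₁.symm).trans ?_
    refine Eq.trans ?_ (Category.id_comp _).symm
    exact (Category.assoc _ _ _).symm.trans (congrArg (· ≫ _) h₂.symm)

end DerivedCategory


/-! ### The quasi-isomorphism from the total complex to the cokernel of the monodromy -/

namespace TropicalSteenbrink.UnimodularComplex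

open Finset CategoryTheory CategoryTheory.Limits CochainComplex
  CochainComplex.HomComplex DerivedCategory

noncomputable section

variable {V D : Type u} [LinearOrder V] [Fintype V] [DecidableEq D] [Fintype D]
  {N : V → Type v} [∀ v, AddCommGroup (N v)] [∀ v, Module.Free ℤ (N v)]
  [∀ v, Module.Finite ℤ (N v)] (X : UnimodularComplex V D N) (o : Finset V → ℤˣ) (p : ℤ)

theorem kernelToCone_fst : X.kernelToCone o p ≫ mappingCocone.fst (X.monodromy o p) =
    kernel.ι (X.monodromy o p) :=
  mappingCocone.lift_fst _ _ _ _

/-- The projection `ST_1^{•,p} → R^{•,p}`, as a cocycle of degree `2` on `ST_1^{•,p}[2]`. -/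
def projection : Cocycle ((X.steenbrinkComplex o p)⟦(2 : ℤ)⟧) (X.cokernelComplex o p) 2 :=
  (Cocycle.ofHom (cokernel.π (X.monodromy o p))).rightShift (-2) 2 (by norm_num)

theorem projection_v (n m : ℤ) (h : n + 2 = m) : (X.projection o p).1.v n m h =
    (cokernel.π (X.monodromy o p)).f n ≫
      ((cokernel (X.monodromy o p)).shiftFunctorObjXIso (-2) m n (by omega)).inv := by
  simp only [projection, Cocycle.rightShift_coe, Cocycle.ofHom_coe]
  rw [Cochain.rightShift_v _ _ _ _ _ _ _ n (by omega), Cochain.ofHom_v]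

/-- This puts `π` in the form required by `quasiIso_of_exact`: the two nested descents each select
the last summand. -/
theorem totalToCokernel_f (n m l : ℤ) (hm : m + 1 = n) (hl : l + 1 = m) :
    (X.totalToCokernel o p).f n =
      mappingCocone.sndSnd (X.kernelToCone o p) n m l hm hl ≫
        (X.projection o p).1.v l n (by omega) := by
  refine (mappingCocone.desc_f _ _ _ _ n m hm).trans ?_
  rw [Cochain.zero_v, comp_zero, zero_add, mappingCocone.sndSnd, Category.assoc]
  congr 1
  rw [Cocycle.rightUnshift_coe, Cochain.rightUnshift_v _ _ _ _ _ _ m (by omega),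
    Cocycle.ofHom_coe, Cochain.ofHom_v]
  refine (congrArg (· ≫ _) (mappingCocone.desc_f _ _ _ _ m l hl)).trans ?_
  rw [Cochain.zero_v, comp_zero, zero_add, Category.assoc]
  congr 1
  -- The shift by `1` in the definition of `h` and the unshift in the definition of `π` are inverse
  -- identifications of degrees.
  rw [Cocycle.rightShift_coe, Cochain.rightShift_v _ _ _ _ _ _ _ n (by omega)]
  exact (Category.assoc _ _ _).trans
    ((congrArg (_ ≫ ·) (Iso.inv_hom_id _)).trans (Category.comp_id _))

/-- Exactness of a sequence of complexes is tested degreewise, so the kernel and the cokernel of the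
monodromy satisfy the hypotheses of `quasiIso_of_exact` in each degree. -/
theorem quasiIso_totalToCokernel : QuasiIso (X.totalToCokernel o p) := by
  have hk : (ShortComplex.mk (kernel.ι (X.monodromy o p)) (X.monodromy o p)
      (kernel.condition _)).Exact := ShortComplex.exact_kernel _
  have hc : (ShortComplex.mk (X.monodromy o p) (cokernel.π (X.monodromy o p))
      (cokernel.condition _)).Exact := ShortComplex.exact_cokernel _
  rw [HomologicalComplex.exact_iff_degreewise_exact] at hk hc
  refine mappingCocone.quasiIso_of_exact (X.kernelToCone_fst o p) (fun n m h => ?_)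
    (fun n => inferInstance) (fun n Z x hx => (hk n).exact_up_to_refinements x hx)
    (X.projection o p) (fun n m h => ?_) (fun n m h Z x hx => ?_) _ (X.totalToCokernel_f o p)
  · rw [kernelToCone, mappingCocone.lift_f_snd_v, Cochain.zero_v]
  · rw [projection_v]
    infer_instance
  · rw [projection_v, ← Category.assoc] at hx
    -- The identification of degrees coming from the shift by `-2` is an isomorphism, so it is
    -- cancelled before exactness at `ST_1^{•,p}[2]` is used.
    exact (hc n).exact_up_to_refinements x ((cancel_mono (((cokernel (X.monodromy o p)).shiftFunctorObjXIso (-2) m n (by omega)).symm.hom)).1 (hx.trans zero_comp.symm))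

/-- The composite of the connecting morphism `C → T[1]` and of `π[1]` is `h`. -/
theorem triangle_mor₃_totalToCokernel :
    (mappingCocone.triangle (X.kernelToCone o p)).mor₃ ≫ (X.totalToCokernel o p)⟦(1 : ℤ)⟧' =
      X.coneToCokernel o p :=
  mappingCocone.triangle_mor₃_comp _ _ _

/-- A face contributing in degree `a` has dimension at least `|a|`, hence more than `|a|` vertices,
which is impossible once `|a|` exceeds the number of all vertices. -/
theorem isZero_steenbrinkComplex (b a : ℤ) (ha : (Fintype.card V : ℤ) < |a|) :
    IsZero ((X.steenbrinkComplex o b).X a) := by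
  have : Subsingleton ((X.steenbrinkComplex o b).X a) := by
    change Subsingleton (X.steenbrink a b)
    refine subsingleton_of_forall_eq 0 fun x => Subtype.ext (funext fun δ => ?_)
    refine (mem_steenbrink.1 x.2).2 δ fun h => ?_
    have := Finset.card_le_univ δ
    have := h.2.1
    omega
  exact ModuleCat.isZero_of_subsingleton _

end

end TropicalSteenbrink.UnimodularComplex

/-! ### Boundedness of the complexes -/

namespace DerivedCategory

open CategoryTheory Limits

variable {C : Type*} [Category* C] [Abelian C] [HasDerivedCategory C]

theorem bounded_Q_obj (K : CochainComplex C ℤ) (n : ℤ) (hK : ∀ a : ℤ, n < |a| → IsZero (K.X a)) :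
    TStructure.t.bounded (Q.obj K) := by
  have h₁ : K.IsStrictlyGE (-n) := (K.isStrictlyGE_iff _).2 fun a ha => hK a (by grind)
  have h₂ : K.IsStrictlyLE n := (K.isStrictlyLE_iff _).2 fun a ha => hK a (by grind)
  exact ⟨⟨-n, inferInstance⟩, ⟨n, inferInstance⟩⟩

end DerivedCategory

namespace TropicalSteenbrink.UnimodularComplex

open Finset CategoryTheory CategoryTheory.Limits CochainComplex
  CochainComplex.HomComplex DerivedCategory

variable {V D : Type u} [LinearOrder V] [Fintype V] [DecidableEq D] [Fintype D]
  {N : V → Type v} [∀ v, AddCommGroup (N v)] [∀ v, Module.Free ℤ (N v)]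
  [∀ v, Module.Finite ℤ (N v)] [HasDerivedCategory.{w} (ModuleCat.{u} ℚ)]
  (X : UnimodularComplex V D N) (o : Finset V → ℤˣ) (p : ℤ)

theorem bounded_steenbrinkComplex (b : ℤ) :
    TStructure.t.bounded (Q.obj (X.steenbrinkComplex o b)) :=
  bounded_Q_obj _ _ (X.isZero_steenbrinkComplex o b)

theorem bounded_shift_steenbrinkComplex (b n : ℤ) :
    TStructure.t.bounded (Q.obj ((X.steenbrinkComplex o b)⟦n⟧)) :=
  (TStructure.t.bounded.prop_iff_of_iso ((Q.commShiftIso n).app _)).2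
    (TStructure.t.bounded.le_shift n _ (X.bounded_steenbrinkComplex o b))

/-- The bounded objects form a triangulated subcategory, and the other two vertices of the cocone
triangle are bounded. -/
theorem bounded_shiftedCone : TStructure.t.bounded (Q.obj (X.shiftedCone o p)) :=
  TStructure.t.bounded.ext_of_isTriangulatedClosed₁ _
    (mappingCocone_triangle_distinguished (X.monodromy o p))
    (X.bounded_steenbrinkComplex o (p + 2)) (X.bounded_shift_steenbrinkComplex o p 2)

/-- In each degree the kernel is a subobject of a term of the Steenbrink complex, so it vanishes
wherever that term does. -/
theorem bounded_kernelComplex : TStructure.t.bounded (Q.obj (X.kernelComplex o p)) :=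
  bounded_Q_obj _ _ fun a ha =>
    (X.isZero_steenbrinkComplex o (p + 2) a ha).of_mono ((kernel.ι (X.monodromy o p)).f a)

/-- `R^{•,p}` is quasi-isomorphic to the cone of bounded complexes. -/
theorem bounded_cokernelComplex : TStructure.t.bounded (Q.obj (X.cokernelComplex o p)) := by
  have := X.quasiIso_totalToCokernel o p
  exact (TStructure.t.bounded.prop_iff_of_iso (asIso (Q.map (X.totalToCokernel o p)))).1
    (TStructure.t.bounded.ext_of_isTriangulatedClosed₁ _
      (mappingCocone_triangle_distinguished (X.kernelToCone o p))
      (X.bounded_kernelComplex o p) (X.bounded_shiftedCone o p))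

end TropicalSteenbrink.UnimodularComplex

/-! ### The two distinguished triangles -/

open CategoryTheory CochainComplex Pretriangulated TropicalSteenbrink
theorem mainTheorem6 {V D : Type u} [LinearOrder V] [Fintype V] [DecidableEq D] [Fintype D]
    {N : V → Type v} [∀ v, AddCommGroup (N v)] [∀ v, Module.Free ℤ (N v)]
    [∀ v, Module.Finite ℤ (N v)] [HasDerivedCategory.{w} (ModuleCat.{u} ℚ)]
    (X : UnimodularComplex V D N) (o : Finset V → ℤˣ) (p : ℤ) (hp : Even p) :
    IsBoundedDistinguished
        (DerivedCategory.Q.mapTriangle.obj (mappingCocone.triangle (X.monodromy o p))) ∧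
      QuasiIso (X.totalToCokernel o p) ∧
      ∃ f : DerivedCategory.Q.obj (X.cokernelComplex o p) ⟶
          DerivedCategory.Q.obj (X.kernelComplex o p),
        DerivedCategory.Q.map (X.totalToCokernel o p) ≫ f =
          DerivedCategory.Q.map (mappingCocone.fst (X.kernelToCone o p)) ∧
        IsBoundedDistinguished (Triangle.mk f (DerivedCategory.Q.map (X.kernelToCone o p))
          (DerivedCategory.Q.map (X.coneToCokernel o p) ≫
            (DerivedCategory.Q.commShiftIso (1 : ℤ)).hom.app (X.cokernelComplex o p))) := by
  have := X.quasiIso_totalToCokernel o p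
  refine ⟨⟨DerivedCategory.mappingCocone_triangle_distinguished _, X.bounded_shiftedCone o p,
      X.bounded_steenbrinkComplex o (p + 2), X.bounded_shift_steenbrinkComplex o p 2⟩, this,
    -- The condition on `f ∘ π` forces this choice of `f`, since `π` is invertible in the derived
    -- category.
    inv (DerivedCategory.Q.map (X.totalToCokernel o p)) ≫
      DerivedCategory.Q.map (mappingCocone.fst (X.kernelToCone o p)), IsIso.hom_inv_id_assoc _ _,
    DerivedCategory.mappingCocone_triangle_replace_distinguished _ _ _
      (X.triangle_mor₃_totalToCokernel o p),
    X.bounded_cokernelComplex o p, X.bounded_kernelComplex o p, X.bounded_shiftedCone o p⟩
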